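/- Let $A,B,C$ be three qubits, let $|abc\rangle$ ($a,b,c\in\{0,1\}$) be the computational basis of $\mathbb C^2\otimes\mathbb C^2\otimes\mathbb C^2$, and let $F_{ABC}=|0\rangle\langle 0|_A\otimes I_{BC}+|1\rangle\langle 1|_A\otimes S_{BC}$ be the Fredkin (controlled-swap) gate, where $S$ is the swap gate $S|bc\rangle=|cb\rangle$; thus $F_{ABC}|0bc\rangle=|0bc\rangle$ and $F_{ABC}|1bc\rangle=|1cb\rangle$. A two-qubit gate is an operator on the three-qubit space that acts as an arbitrary $4\times4$ unitary on one of the pairs $AB$, $AC$, $BC$ and as the identity on the remaining qubit. Four two-qubit gates are not sufficient for implementing $F_{ABC}$: there are no two-qubit gates $G_1,G_2,G_3,G_4$ (each acting on any of the three pairs) with $G_1G_2G_3G_4=F_{ABC}$. Moreover, five two-qubit gates are optimal: $F_{ABC}$ is a product of five two-qubit gates, and it is not a product of $n$ two-qubit gates for any $n<5$. -/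

import Mathlib

namespace ThreeQubit

/-- Labels of the computational basis of the two-qubit space. -/
abbrev Idx2 : Type := Fin 2 × Fin 2

/-- Labels of the computational basis `|abc⟩` of the three-qubit space; the three components belong
to the qubits `A`, `B`, `C` in this order. -/
abbrev Idx3 : Type := Fin 2 × Fin 2 × Fin 2

/-- The operator on `ABC` that acts as `U` on the pair `AB` and as the identity on `C`. -/
def onAB (U : Matrix Idx2 Idx2 ℂ) : Matrix Idx3 Idx3 ℂ :=
  Matrix.of fun (a, b, c) (a', b', c') => if c = c' then U (a, b) (a', b') else 0

/-- The operator on `ABC` that acts as `U` on the pair `AC` and as the identity on `B`. -/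
def onAC (U : Matrix Idx2 Idx2 ℂ) : Matrix Idx3 Idx3 ℂ :=
  Matrix.of fun (a, b, c) (a', b', c') => if b = b' then U (a, c) (a', c') else 0

/-- The operator on `ABC` that acts as `U` on the pair `BC` and as the identity on `A`. -/
def onBC (U : Matrix Idx2 Idx2 ℂ) : Matrix Idx3 Idx3 ℂ :=
  Matrix.of fun (a, b, c) (a', b', c') => if a = a' then U (b, c) (b', c') else 0

/-- The class of two-qubit gates on the subsystem `AB`. -/
def KAB : Set (Matrix Idx3 Idx3 ℂ) := {G | ∃ U ∈ Matrix.unitaryGroup Idx2 ℂ, G = onAB U}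

/-- The class of two-qubit gates on the subsystem `AC`. -/
def KAC : Set (Matrix Idx3 Idx3 ℂ) := {G | ∃ U ∈ Matrix.unitaryGroup Idx2 ℂ, G = onAC U}

/-- The class of two-qubit gates on the subsystem `BC`. -/
def KBC : Set (Matrix Idx3 Idx3 ℂ) := {G | ∃ U ∈ Matrix.unitaryGroup Idx2 ℂ, G = onBC U}

/-- A two-qubit gate on the three-qubit system: an arbitrary two-qubit unitary acting on one of the
three pairs of qubits. -/
def IsTwoQubitGate (G : Matrix Idx3 Idx3 ℂ) : Prop := G ∈ KAB ∨ G ∈ KAC ∨ G ∈ KBC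

/-- `F` is implemented by a circuit of `n` two-qubit gates (without ancilla). -/
def ImplementableBy (n : ℕ) (F : Matrix Idx3 Idx3 ℂ) : Prop :=
  ∃ G : Fin n → Matrix Idx3 Idx3 ℂ, (∀ i, IsTwoQubitGate (G i)) ∧ (List.ofFn G).prod = F

/-- The Fredkin gate `|0⟩⟨0| ⊗ I + |1⟩⟨1| ⊗ S`: it sends `|0bc⟩` to `|0bc⟩` and `|1bc⟩` to
`|1cb⟩`. -/
def fredkin : Matrix Idx3 Idx3 ℂ :=
  Matrix.of fun x (a, b, c) => if x = (if a = 1 then (a, c, b) else (a, b, c)) then 1 else 0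

end ThreeQubit

open scoped Kronecker Matrix

namespace ThreeQubit

/-! Lower bound: merging neighbouring gates on the same pair leaves words of length four in AB, AC,
BC without equal neighbours. Adjoints, the exchange of B and C, swaps inserted between gates and,
once, X on A reduce these 24 words to three. Their exclusion needs only invertibility.

BC·AB·AC·BC (`onBC_onAB_onAC_onBC_ne_fredkin`): without the outer gates, the product AB·AC is block
diagonal in A, and this forces its blocks to be tensor products
(`exists_kronecker_of_onAB_mul_onAC`). The quotient of the blocks is similar to S, but no P ⊗ Q is.

AB·AC·AB·AC (`onAB_onAC_onAB_ne_fredkin_mul_onAC`): a matrix element of AB·AC·AB along C has the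
form U(a ⊗ 1)W, so its kernel has even dimension. For F·t_AC this makes minors of t vanish
(`minor_eq_zero_of_fredkin_mul_onAC`), contrary to the invertibility of t.

AB·AC·AB·BC (`onAB_onAC_onAB_ne_fredkin_mul_onBC`): operators on B commute with the AC gate.
Together with the control structure of F this makes V intertwine a nonscalar p on A with an operator
on AB, so some matrix element of V along C vanishes. Then z would map a plane injectively into a
line.

Upper bound (`implementableBy_five_fredkin`): F is a Toffoli gate conjugated by a CNOT on BC, and
both CNOTs are absorbed into gates of the square-root-of-X construction of Toffoli. -/

/-! ### Algebra of embedded two-qubit operators -/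

lemma onAB_mul (U V : Matrix Idx2 Idx2 ℂ) : onAB U * onAB V = onAB (U * V) := by
  ext ⟨a, b, c⟩ ⟨a', b', c'⟩
  by_cases h : c = c' <;>
  simp [Matrix.mul_apply, Fintype.sum_prod_type, onAB, h]

lemma onAC_mul (U V : Matrix Idx2 Idx2 ℂ) : onAC U * onAC V = onAC (U * V) := by
  ext ⟨a, b, c⟩ ⟨a', b', c'⟩
  by_cases h : b = b' <;>
  simp [Matrix.mul_apply, Fintype.sum_prod_type, onAC, h]

lemma onBC_mul (U V : Matrix Idx2 Idx2 ℂ) : onBC U * onBC V = onBC (U * V) := by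
  ext ⟨a, b, c⟩ ⟨a', b', c'⟩
  by_cases h : a = a' <;>
  simp [Matrix.mul_apply, Fintype.sum_prod_type, onBC, h]

lemma onAB_one : onAB 1 = 1 := by
  ext ⟨a, b, c⟩ ⟨a', b', c'⟩
  simp only [onAB, Matrix.of_apply, Matrix.one_apply, Prod.mk.injEq]
  split_ifs <;> simp_all

lemma onAC_one : onAC 1 = 1 := by
  ext ⟨a, b, c⟩ ⟨a', b', c'⟩
  simp only [onAC, Matrix.of_apply, Matrix.one_apply, Prod.mk.injEq]
  split_ifs <;> simp_all

lemma onBC_one : onBC 1 = 1 := by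
  ext ⟨a, b, c⟩ ⟨a', b', c'⟩
  simp only [onBC, Matrix.of_apply, Matrix.one_apply, Prod.mk.injEq]
  split_ifs <;> simp_all

lemma star_onAB (U : Matrix Idx2 Idx2 ℂ) : star (onAB U) = onAB (star U) := by
  ext ⟨a, b, c⟩ ⟨a', b', c'⟩
  simp only [onAB, Matrix.star_apply, Matrix.of_apply, eq_comm (a := c)]
  split_ifs <;> simp

lemma star_onAC (U : Matrix Idx2 Idx2 ℂ) : star (onAC U) = onAC (star U) := by
  ext ⟨a, b, c⟩ ⟨a', b', c'⟩
  simp only [onAC, Matrix.star_apply, Matrix.of_apply, eq_comm (a := b)]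
  split_ifs <;> simp

lemma star_onBC (U : Matrix Idx2 Idx2 ℂ) : star (onBC U) = onBC (star U) := by
  ext ⟨a, b, c⟩ ⟨a', b', c'⟩
  simp only [onBC, Matrix.star_apply, Matrix.of_apply, eq_comm (a := a)]
  split_ifs <;> simp

/-! ### The swap gate and operators controlled by A -/

/-- The two-qubit swap gate. -/
def swapGate : Matrix Idx2 Idx2 ℂ := Matrix.of fun x y => if x = y.swap then 1 else 0

lemma swapGate_apply (a b a' b' : Fin 2) :
    swapGate (a, b) (a', b') = if a = b' ∧ b = a' then 1 else 0 := by
  simp [swapGate]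

lemma swapGate_mul_apply (M : Matrix Idx2 Idx2 ℂ) (x y : Idx2) :
    (swapGate * M) x y = M x.swap y := by
  obtain ⟨a, b⟩ := x
  fin_cases a <;> fin_cases b <;> simp [Matrix.mul_apply, Fintype.sum_prod_type, swapGate_apply]

lemma mul_swapGate_apply (M : Matrix Idx2 Idx2 ℂ) (x y : Idx2) :
    (M * swapGate) x y = M x y.swap := by
  simp only [Matrix.mul_apply, swapGate, Matrix.of_apply, mul_ite, mul_one, mul_zero]
  rw [Finset.sum_eq_single y.swap] <;> simp +contextual

lemma swapGate_mul_self : swapGate * swapGate = 1 := by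
  ext x y
  rw [swapGate_mul_apply]
  simp [swapGate, Matrix.one_apply]

lemma star_swapGate : star swapGate = swapGate := by
  ext ⟨a, b⟩ ⟨a', b'⟩
  simp only [Matrix.star_apply, swapGate_apply]
  split_ifs <;> simp_all

lemma swapGate_mem : swapGate ∈ Matrix.unitaryGroup Idx2 ℂ := by
  rw [Matrix.mem_unitaryGroup_iff, star_swapGate, swapGate_mul_self]

/-- The operator that acts as `M a` on `BC` when the qubit `A` is in the state `a`. -/
def controlled (M : Fin 2 → Matrix Idx2 Idx2 ℂ) : Matrix Idx3 Idx3 ℂ :=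
  Matrix.of fun (a, x) (a', x') => if a = a' then M a x x' else 0

lemma controlled_apply (M : Fin 2 → Matrix Idx2 Idx2 ℂ) (a a' : Fin 2) (x x' : Idx2) :
    controlled M (a, x) (a', x') = if a = a' then M a x x' else 0 := rfl

lemma controlled_mul (M N : Fin 2 → Matrix Idx2 Idx2 ℂ) :
    controlled M * controlled N = controlled fun a => M a * N a := by
  ext ⟨a, x⟩ ⟨a', x'⟩
  rw [Matrix.mul_apply, Fintype.sum_prod_type, Finset.sum_eq_single a]
  · by_cases h : a = a' <;> simp [controlled_apply, Matrix.mul_apply, h]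
  · intro j _ hj
    simp [controlled_apply, hj.symm]
  · simp

lemma onBC_eq_controlled (U : Matrix Idx2 Idx2 ℂ) : onBC U = controlled fun _ => U := rfl

lemma fredkin_eq_controlled : fredkin = controlled ![1, swapGate] := by
  ext ⟨a, b, c⟩ ⟨a', b', c'⟩
  fin_cases a <;> fin_cases a' <;>
    simp [fredkin, controlled_apply, swapGate_apply, Matrix.one_apply]

lemma star_fredkin : star fredkin = fredkin := by
  ext ⟨a, b, c⟩ ⟨a', b', c'⟩
  rw [fredkin_eq_controlled]
  fin_cases a <;> fin_cases a' <;>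
    simp [Matrix.star_apply, controlled_apply, swapGate_apply, Matrix.one_apply, apply_ite,
      and_comm, eq_comm]

/-- Exchanging the qubits `B` and `C`. -/
def swapBC : Idx3 ≃ Idx3 := Equiv.prodCongr (Equiv.refl _) (Equiv.prodComm _ _)

/-- Conjugation of a three-qubit operator by the swap of `B` and `C`. -/
def conjBC (G : Matrix Idx3 Idx3 ℂ) : Matrix Idx3 Idx3 ℂ := G.submatrix swapBC swapBC

lemma conjBC_mul (G H : Matrix Idx3 Idx3 ℂ) : conjBC (G * H) = conjBC G * conjBC H :=
  (Matrix.submatrix_mul_equiv _ _ _ _ _).symm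

lemma conjBC_onAC (U : Matrix Idx2 Idx2 ℂ) : conjBC (onAC U) = onAB U := rfl

lemma onBC_swapGate_mul (G : Matrix Idx3 Idx3 ℂ) :
    onBC swapGate * G * onBC swapGate = conjBC G := by
  ext ⟨a, b, c⟩ ⟨a', b', c'⟩
  simp [Matrix.mul_apply, Fintype.sum_prod_type, onBC, conjBC, swapBC, swapGate_apply, ite_and]

lemma conjBC_onBC (U : Matrix Idx2 Idx2 ℂ) :
    conjBC (onBC U) = onBC (swapGate * U * swapGate) := by
  rw [← onBC_swapGate_mul, onBC_mul, onBC_mul]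

lemma conjBC_fredkin : conjBC fredkin = fredkin := by
  rw [← onBC_swapGate_mul, fredkin_eq_controlled, onBC_eq_controlled, controlled_mul,
    controlled_mul]
  congr 1
  ext a : 1
  fin_cases a <;> simp [swapGate_mul_self]

lemma onAB_swapGate_onBC (V : Matrix Idx2 Idx2 ℂ) :
    onAB swapGate * onAC V * onAB swapGate = onBC V := by
  ext ⟨a, b, c⟩ ⟨a', b', c'⟩
  simp [Matrix.mul_apply, Fintype.sum_prod_type, onAB, onAC, onBC, swapGate_apply, ite_and]

/-! ### The word BC·AB·AC·BC -/

lemma trace_swapGate : swapGate.trace = 2 := by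
  simp only [Matrix.trace, Fintype.sum_prod_type, Fin.sum_univ_two, Matrix.diag_apply,
    swapGate_apply]
  norm_num

/-- Similarity to S would give P² ⊗ Q² = 1 and tr P · tr Q = 2. Then P² and Q² are scalar while the
traces are nonzero, so P and Q are scalar (for instance (P²)₀₁ = P₀₁ tr P). Hence P ⊗ Q = ±1, whose
trace is ±4. -/
lemma kronecker_mul_ne_mul_swapGate (P Q : Matrix (Fin 2) (Fin 2) ℂ)
    (g : (Matrix Idx2 Idx2 ℂ)ˣ) : (P ⊗ₖ Q) * g.val ≠ g.val * swapGate := by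
  intro h
  have hM : P ⊗ₖ Q = g.val * swapGate * (g⁻¹).val := by rw [← h]; simp [mul_assoc]
  have htr : P.trace * Q.trace = 2 := by
    rw [← Matrix.trace_kronecker, hM, Matrix.trace_mul_comm, ← mul_assoc]
    simp [trace_swapGate]
  have hsq : (P * P) ⊗ₖ (Q * Q) = 1 := by
    rw [Matrix.mul_kronecker_mul, hM]
    calc g.val * swapGate * (g⁻¹).val * (g.val * swapGate * (g⁻¹).val)
        = g.val * swapGate * ((g⁻¹).val * g.val) * swapGate * (g⁻¹).val := by simp only [mul_assoc]
      _ = g.val * (swapGate * swapGate) * (g⁻¹).val := by simp [mul_assoc]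
      _ = 1 := by simp [swapGate_mul_self]
  have e (a b a' b' : Fin 2) : (P * P) a a' * (Q * Q) b b' =
      (1 : Matrix Idx2 Idx2 ℂ) (a, b) (a', b') := by
    rw [← hsq]; rfl
  have h1 := e 0 0 0 0
  have h2 := e 1 0 1 0
  have h3 := e 0 0 1 0
  have h4 := e 1 0 0 0
  have h5 := e 0 1 0 1
  have h6 := e 0 0 0 1
  have h7 := e 0 1 0 0
  simp only [Matrix.one_apply_eq] at h1 h2 h5
  rw [Matrix.one_apply_ne (by simp)] at h3 h4 h6 h7
  have hP := left_ne_zero_of_mul_eq_one h1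
  have hQ := right_ne_zero_of_mul_eq_one h1
  have k3 := (mul_eq_zero.1 h3).resolve_right hQ
  have k4 := (mul_eq_zero.1 h4).resolve_right hQ
  have k6 := (mul_eq_zero.1 h6).resolve_left hP
  have k7 := (mul_eq_zero.1 h7).resolve_left hP
  have k2 : (P * P) 1 1 = (P * P) 0 0 := mul_right_cancel₀ hQ (h2.trans h1.symm)
  have k5 : (Q * Q) 1 1 = (Q * Q) 0 0 := mul_left_cancel₀ hP (h5.trans h1.symm)
  clear h2 h3 h4 h5 h6 h7 e hsq hM h hP hQ
  simp only [Matrix.mul_apply, Fin.sum_univ_two, Matrix.trace_fin_two] at *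
  have tP : P 0 0 + P 1 1 ≠ 0 := fun h => by simp [h] at htr
  have tQ : Q 0 0 + Q 1 1 ≠ 0 := fun h => by simp [h] at htr
  have p01 : P 0 1 = 0 := by
    refine (mul_eq_zero.1 ?_).resolve_right tP
    linear_combination k3
  have q01 : Q 0 1 = 0 := by
    refine (mul_eq_zero.1 ?_).resolve_right tQ
    linear_combination k6
  have p : P 0 0 - P 1 1 = 0 := by
    refine (mul_eq_zero.1 ?_).resolve_right tP
    linear_combination -k2
  have q : Q 0 0 - Q 1 1 = 0 := by
    refine (mul_eq_zero.1 ?_).resolve_right tQ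
    linear_combination -k5
  rw [p01, q01] at h1
  rw [← sub_eq_zero.1 p, ← sub_eq_zero.1 q] at htr
  have : (4 : ℂ) * 1 = 1 := by
    have hh : P 0 0 * Q 0 0 = 1 / 2 := by linear_combination htr / 4
    linear_combination -4 * h1 + 4 * (P 0 0 * Q 0 0 + 1 / 2) * hh
  norm_num at this

/-- If `U_AB W_AC` is block diagonal with respect to the qubit `A` and its blocks do not vanish,
then the blocks are Kronecker products. -/
lemma exists_kronecker_of_onAB_mul_onAC {U W : Matrix Idx2 Idx2 ℂ}
    {M : Fin 2 → Matrix Idx2 Idx2 ℂ} (h : onAB U * onAC W = controlled M) (hM : ∀ a, M a ≠ 0) :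
    ∀ a, ∃ P Q : Matrix (Fin 2) (Fin 2) ℂ, M a = P ⊗ₖ Q := by
  have e (i b c k b' c' : Fin 2) : U (i, b) (0, b') * W (0, c) (k, c') +
      U (i, b) (1, b') * W (1, c) (k, c') = if i = k then M i (b, c) (b', c') else 0 := by
    have := congrFun (congrFun h (i, b, c)) (k, b', c')
    rw [controlled_apply] at this
    rw [← this]
    simp [Matrix.mul_apply, Fintype.sum_prod_type, onAB, onAC]
  have e0 (b c b' c') := e 0 b c 0 b' c'
  have e1 (b c b' c') := e 1 b c 1 b' c'
  have e01 (b c b' c') := e 0 b c 1 b' c'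
  simp only [if_true, zero_ne_one, if_false] at e0 e1 e01
  have hne (a : Fin 2) : ¬ ∀ b c b' c', M a (b, c) (b', c') = 0 := fun h0 =>
    hM a (by ext ⟨b, c⟩ ⟨b', c'⟩; exact h0 b c b' c')
  -- Only the off-diagonal block U₀₀ ⊗ W₀₁ + U₀₁ ⊗ W₁₁ = 0 is needed. If W₁₁ = 0, nonzero diagonal
  -- blocks force U₀₀ = 0, and one term survives in each. Otherwise U₀₁ = l U₀₀ and W₀₁ = -l W₁₁,
  -- and both diagonal blocks factor.
  by_cases h11 : ∀ c c', W (1, c) (1, c') = 0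
  · by_cases h00 : ∀ b b', U (0, b) (0, b') = 0
    · refine Fin.forall_fin_two.2 ⟨⟨Matrix.of fun b b' => U (0, b) (1, b'),
        Matrix.of fun c c' => W (1, c) (0, c'), ?_⟩, ⟨Matrix.of fun b b' => U (1, b) (0, b'),
        Matrix.of fun c c' => W (0, c) (1, c'), ?_⟩⟩
      · ext ⟨b, c⟩ ⟨b', c'⟩
        simp [← e0, h00]
      · ext ⟨b, c⟩ ⟨b', c'⟩
        simp [← e1, h11]
    · push Not at h00
      obtain ⟨b, b', hb⟩ := h00
      refine absurd (fun b₁ c b₁' c' => ?_) (hne 1)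
      have := e01 b c b' c'
      simp only [h11, mul_zero, add_zero, mul_eq_zero, hb, false_or] at this
      simp [← e1, h11, this]
  · push Not at h11
    obtain ⟨d, d', hd⟩ := h11
    obtain ⟨l, hl⟩ : ∃ l, ∀ b b', U (0, b) (1, b') = l * U (0, b) (0, b') :=
      ⟨-W (0, d) (1, d') / W (1, d) (1, d'), fun b b' => by
        field_simp
        linear_combination e01 b d b' d'⟩
    by_cases h00 : ∀ b b', U (0, b) (0, b') = 0
    · exact absurd (fun b c b' c' => by simp [← e0, hl, h00]) (hne 0)
    push Not at h00
    obtain ⟨f, f', hf⟩ := h00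
    have hl' (c c') : W (0, c) (1, c') = -l * W (1, c) (1, c') := by
      have := e01 f c f' c'
      rw [hl] at this
      apply mul_left_cancel₀ hf
      linear_combination this
    refine Fin.forall_fin_two.2 ⟨⟨Matrix.of fun b b' => U (0, b) (0, b'),
        Matrix.of fun c c' => W (0, c) (0, c') + l * W (1, c) (0, c'), ?_⟩,
        ⟨Matrix.of fun b b' => U (1, b) (1, b') - l * U (1, b) (0, b'),
        Matrix.of fun c c' => W (1, c) (1, c'), ?_⟩⟩
    · ext ⟨b, c⟩ ⟨b', c'⟩
      simp only [← e0, hl, Matrix.kronecker_apply, Matrix.of_apply]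
      ring
    · ext ⟨b, c⟩ ⟨b', c'⟩
      simp only [← e1, hl', Matrix.kronecker_apply, Matrix.of_apply]
      ring

theorem onBC_onAB_onAC_onBC_ne_fredkin (g g' : (Matrix Idx2 Idx2 ℂ)ˣ)
    (U W : Matrix Idx2 Idx2 ℂ) : onBC g.val * onAB U * onAC W * onBC g'.val ≠ fredkin := by
  intro h
  have h2 : onAB U * onAC W = controlled fun a => (g⁻¹).val * ![1, swapGate] a * (g'⁻¹).val := by
    have : onAB U * onAC W = onBC (g⁻¹).val * fredkin * onBC (g'⁻¹).val := by
      rw [← h]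
      calc onAB U * onAC W = onBC ((g⁻¹).val * g.val) * (onAB U * onAC W) * onBC (g'.val * (g'⁻¹).val) := by
            simp [onBC_one]
        _ = _ := by simp only [← onBC_mul, mul_assoc]
    rw [this, fredkin_eq_controlled, onBC_eq_controlled, onBC_eq_controlled, controlled_mul,
      controlled_mul]
  have hS : IsUnit swapGate := ⟨⟨_, _, swapGate_mul_self, swapGate_mul_self⟩, rfl⟩
  have hu : ∀ a : Fin 2, IsUnit (![1, swapGate] a : Matrix Idx2 Idx2 ℂ) :=
    Fin.forall_fin_two.2 ⟨isUnit_one, hS⟩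
  have hk := exists_kronecker_of_onAB_mul_onAC h2 fun a =>
    (((g⁻¹).isUnit.mul (hu a)).mul (g'⁻¹).isUnit).ne_zero
  obtain ⟨P, Q, h0⟩ := hk 0
  obtain ⟨P', Q', h1⟩ := hk 1
  simp only [Matrix.cons_val_zero, Matrix.cons_val_one, mul_one] at h0 h1
  have hinv : P⁻¹ ⊗ₖ Q⁻¹ = g'.val * g.val := by
    rw [← Matrix.inv_kronecker, ← h0]
    apply Matrix.inv_eq_right_inv
    simp [mul_assoc]
  apply kronecker_mul_ne_mul_swapGate (P' * P⁻¹) (Q' * Q⁻¹) g⁻¹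
  rw [Matrix.mul_kronecker_mul, hinv, ← h1]
  simp [mul_assoc]

/-! ### The word AB·AC·AB·AC: matrix elements along C -/

/-- The partial matrix element `⟨δ| G |γ⟩` with respect to the qubit `C`, an operator on `AB`. -/
def sliceC (δ γ : Fin 2 → ℂ) (G : Matrix Idx3 Idx3 ℂ) : Matrix Idx2 Idx2 ℂ :=
  Matrix.of fun (a, b) (a', b') => ∑ c, ∑ c', δ c * G (a, b, c) (a', b', c') * γ c'

/-- The partial matrix element `⟨δ| V |γ⟩` of an operator on `AC` with respect to the qubit `C`. -/
def partialC (δ γ : Fin 2 → ℂ) (V : Matrix Idx2 Idx2 ℂ) : Matrix (Fin 2) (Fin 2) ℂ :=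
  Matrix.of fun a a' => ∑ c, ∑ c', δ c * V (a, c) (a', c') * γ c'

lemma sliceC_onAB_mul (δ γ : Fin 2 → ℂ) (U : Matrix Idx2 Idx2 ℂ) (G : Matrix Idx3 Idx3 ℂ) :
    sliceC δ γ (onAB U * G) = U * sliceC δ γ G := by
  ext ⟨a, b⟩ ⟨a', b'⟩
  simp [sliceC, Matrix.mul_apply, Fintype.sum_prod_type, onAB]
  ring

lemma sliceC_mul_onAB (δ γ : Fin 2 → ℂ) (G : Matrix Idx3 Idx3 ℂ) (W : Matrix Idx2 Idx2 ℂ) :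
    sliceC δ γ (G * onAB W) = sliceC δ γ G * W := by
  ext ⟨a, b⟩ ⟨a', b'⟩
  simp [sliceC, Matrix.mul_apply, Fintype.sum_prod_type, onAB]
  ring

lemma sliceC_onAC (δ γ : Fin 2 → ℂ) (V : Matrix Idx2 Idx2 ℂ) :
    sliceC δ γ (onAC V) = partialC δ γ V ⊗ₖ 1 := by
  ext ⟨a, b⟩ ⟨a', b'⟩
  by_cases h : b = b' <;> simp [sliceC, partialC, onAC, h]

lemma exists_ne_zero_mul_add_mul_eq_zero (x y : ℂ) :
    ∃ μ : Fin 2 → ℂ, μ ≠ 0 ∧ x * μ 0 + y * μ 1 = 0 := by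
  by_cases h : x = 0 ∧ y = 0
  · exact ⟨fun _ => 1, fun h => one_ne_zero (congrFun h 0), by simp [h]⟩
  · refine ⟨![y, -x], fun h0 => h ?_, ?_⟩
    · have h1 := congrFun h0 0
      have h2 := congrFun h0 1
      simp_all
    · simp only [Matrix.cons_val_zero, Matrix.cons_val_one]
      ring

/-- An operator of the form `U (a ⊗ 1) W` with a nontrivial kernel has a kernel vector in every
hyperplane. -/
lemma exists_mulVec_eq_zero_of_kronecker_one (U W : (Matrix Idx2 Idx2 ℂ)ˣ)
    (a : Matrix (Fin 2) (Fin 2) ℂ) {v : Idx2 → ℂ} (hv : v ≠ 0)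
    (h : (U.val * (a ⊗ₖ 1) * W.val) *ᵥ v = 0) (i : Idx2) :
    ∃ w : Idx2 → ℂ, w ≠ 0 ∧ (U.val * (a ⊗ₖ 1) * W.val) *ᵥ w = 0 ∧ w i = 0 := by
  have hdet : (U.val * (a ⊗ₖ 1) * W.val).det = 0 :=
    Matrix.exists_mulVec_eq_zero_iff.1 ⟨v, hv, h⟩
  rw [Matrix.det_mul, Matrix.det_mul, Matrix.det_kronecker] at hdet
  have hU := ((Matrix.isUnit_iff_isUnit_det _).1 U.isUnit).ne_zero
  have hW := ((Matrix.isUnit_iff_isUnit_det _).1 W.isUnit).ne_zero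
  have ha : a.det = 0 := by simpa [hU, hW] using hdet
  obtain ⟨u, hu, hau⟩ := Matrix.exists_mulVec_eq_zero_iff.2 ha
  -- With u in the kernel of a, all W⁻¹(u ⊗ y) lie in the kernel of the product. They form a plane
  -- spanned by `f 0` and `f 1`, which meets every hyperplane.
  let f (b : Fin 2) : Idx2 → ℂ := (W⁻¹).val *ᵥ fun x => if x.2 = b then u x.1 else 0
  obtain ⟨y, hy, hyi⟩ := exists_ne_zero_mul_add_mul_eq_zero (f 0 i) (f 1 i)
  have hf : y 0 • f 0 + y 1 • f 1 = (W⁻¹).val *ᵥ fun x => u x.1 * y x.2 := by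
    rw [← Matrix.mulVec_smul, ← Matrix.mulVec_smul, ← Matrix.mulVec_add]
    congr 1
    ext ⟨p, q⟩
    fin_cases q <;> simp [mul_comm]
  refine ⟨y 0 • f 0 + y 1 • f 1, ?_, ?_, ?_⟩
  · intro h0
    have h1 : (fun x : Idx2 => u x.1 * y x.2) = 0 := by
      have := congrArg (W.val *ᵥ ·) (hf.symm.trans h0)
      simpa using this
    obtain ⟨p, hp⟩ := Function.ne_iff.1 hu
    obtain ⟨q, hq⟩ := Function.ne_iff.1 hy
    exact mul_ne_zero hp hq (congrFun h1 (p, q))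
  · rw [hf, Matrix.mulVec_mulVec, mul_assoc _ W.val, Units.mul_inv, mul_one,
      ← Matrix.mulVec_mulVec]
    have h0 : (a ⊗ₖ (1 : Matrix (Fin 2) (Fin 2) ℂ)) *ᵥ (fun x => u x.1 * y x.2) = 0 := by
      ext ⟨p, q⟩
      have := congrFun hau p
      simp only [Matrix.mulVec, dotProduct, Fin.sum_univ_two, Pi.zero_apply] at this
      simp only [Matrix.mulVec, dotProduct, Fintype.sum_prod_type, Matrix.kronecker_apply,
        Matrix.one_apply, mul_ite, mul_one, mul_zero, ite_mul, zero_mul, Finset.sum_ite_eq,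
        Finset.mem_univ, if_true, Fin.sum_univ_two (f := fun x => a p x * (u x * y q)),
        Pi.zero_apply]
      linear_combination y q * this
    rw [h0, Matrix.mulVec_zero]
  · simp only [Pi.add_apply, Pi.smul_apply, smul_eq_mul]
    linear_combination hyi

lemma fredkin_mul_apply_zero (G : Matrix Idx3 Idx3 ℂ) (b c : Fin 2) (y : Idx3) :
    (fredkin * G) (0, b, c) y = G (0, b, c) y := by
  rw [fredkin_eq_controlled, Matrix.mul_apply, Finset.sum_eq_single (0, b, c)]
  · simp [controlled_apply]
  · rintro ⟨a', b', c'⟩ - hne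
    by_cases h : a' = 0 <;> simp_all [controlled_apply, eq_comm]
  · simp

lemma fredkin_mul_apply_one (G : Matrix Idx3 Idx3 ℂ) (b c : Fin 2) (y : Idx3) :
    (fredkin * G) (1, b, c) y = G (1, c, b) y := by
  rw [fredkin_eq_controlled, Matrix.mul_apply, Finset.sum_eq_single (1, c, b)]
  · simp [controlled_apply, swapGate_apply]
  · rintro ⟨a', b', c'⟩ - hne
    by_cases h : a' = 1
    · have : ¬ (b = c' ∧ c = b') := by rintro ⟨rfl, rfl⟩; exact hne (by rw [h])
      simp [controlled_apply, swapGate_apply, this]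
    · simp [controlled_apply, eq_comm, h]
  · simp

/-- If the minor were nonzero, the element H of F·t_AC along C would have a one-dimensional kernel:
F makes the rows with A = 1 see only the columns with B = c, so the kernel lives on B = d ≠ c and is
cut out there by one nonzero row. But H = U(a ⊗ 1)W has a kernel of even dimension. -/
lemma minor_eq_zero_of_fredkin_mul_onAC (U W : (Matrix Idx2 Idx2 ℂ)ˣ) {V t : Matrix Idx2 Idx2 ℂ}
    (h : onAB U.val * onAC V * onAB W.val = fredkin * onAC t) (γ : Fin 2 → ℂ) (c k : Fin 2) :
    ((t *ᵥ fun x => if x.1 = 0 then γ x.2 else 0) (0, c)) *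
      ((t *ᵥ fun x => if x.1 = 1 then γ x.2 else 0) (1, k)) =
    ((t *ᵥ fun x => if x.1 = 1 then γ x.2 else 0) (0, c)) *
      ((t *ᵥ fun x => if x.1 = 0 then γ x.2 else 0) (1, k)) := by
  set s : Idx2 → Fin 2 → ℂ := fun x j => (t *ᵥ fun x => if x.1 = j then γ x.2 else 0) x with hs
  change s (0, c) 0 * s (1, k) 1 = s (0, c) 1 * s (1, k) 0
  set H := sliceC (Pi.single c 1) γ (fredkin * onAC t) with hH
  have hH0 (b a' b' : Fin 2) : H (0, b) (a', b') = if b = b' then s (0, c) a' else 0 := by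
    simp only [hH, sliceC, Matrix.of_apply, fredkin_mul_apply_zero, hs]
    by_cases hb : b = b' <;>
      fin_cases a' <;> simp [Pi.single_apply, onAC, Matrix.mulVec, dotProduct, Fintype.sum_prod_type, hb]
  have hH1 (b a' b' : Fin 2) : H (1, b) (a', b') = if c = b' then s (1, b) a' else 0 := by
    simp only [hH, sliceC, Matrix.of_apply, fredkin_mul_apply_one, hs]
    by_cases hb : b' = c <;>
      fin_cases a' <;> simp [Pi.single_apply, onAC, Matrix.mulVec, dotProduct,
        Fintype.sum_prod_type, hb, Ne.symm]
  have hH' : H = U.val * (partialC (Pi.single c 1) γ V ⊗ₖ 1) * W.val := by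
    rw [hH, ← h, sliceC_mul_onAB, sliceC_onAB_mul, sliceC_onAC]
  by_contra hne
  obtain ⟨d, hd⟩ : ∃ d : Fin 2, d ≠ c := exists_ne c
  have hmv0 (w : Idx2 → ℂ) (b : Fin 2) :
      (H *ᵥ w) (0, b) = s (0, c) 0 * w (0, b) + s (0, c) 1 * w (1, b) := by
    simp [Matrix.mulVec, dotProduct, Fintype.sum_prod_type, hH0]
  have hmv1 (w : Idx2 → ℂ) (b : Fin 2) :
      (H *ᵥ w) (1, b) = s (1, b) 0 * w (0, c) + s (1, b) 1 * w (1, c) := by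
    simp [Matrix.mulVec, dotProduct, Fintype.sum_prod_type, hH1]
  obtain ⟨j, j', hj, hjj'⟩ : ∃ j j' : Fin 2, s (0, c) j ≠ 0 ∧ (j = 0 ∧ j' = 1 ∨ j = 1 ∧ j' = 0) := by
    by_cases h0 : s (0, c) 0 = 0
    · refine ⟨1, 0, fun h1 => hne (by simp [h0, h1]), by simp⟩
    · exact ⟨0, 1, h0, by simp⟩
  -- The explicit kernel vector v is nonzero at (j', d), so a kernel vector vanishing there is
  -- independent of v. The rows of H then force it to be zero.
  obtain ⟨w, hw, hHw, hwi⟩ := exists_mulVec_eq_zero_of_kronecker_one U W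
    (partialC (Pi.single c 1) γ V)
    (v := fun x => if x.2 = d then (if x.1 = 0 then s (0, c) 1 else -s (0, c) 0) else 0)
    (fun h0 => hj (by
      have h1 := congrFun h0 (j', d)
      rcases hjj' with ⟨rfl, rfl⟩ | ⟨rfl, rfl⟩ <;> simpa using h1))
    (by
      rw [← hH']
      ext ⟨a, b⟩
      fin_cases a
      · refine (hmv0 _ b).trans ?_
        by_cases hb : b = d <;> simp [hb]
        ring
      · refine (hmv1 _ b).trans ?_
        simp [hd.symm]) (j', d)
  rw [← hH'] at hHw
  have r (a b : Fin 2) : (H *ᵥ w) (a, b) = 0 := congrFun hHw (a, b)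
  have r1 := r 0 d
  have r2 := r 0 c
  have r3 := r 1 k
  rw [hmv0] at r1 r2
  rw [hmv1] at r3
  have hwj : w (j, d) = 0 := by
    apply (mul_eq_zero.1 _).resolve_left hj
    rcases hjj' with ⟨rfl, rfl⟩ | ⟨rfl, rfl⟩ <;> simpa [hwi] using r1
  have q0 : w (0, c) = 0 := by
    apply (mul_eq_zero.1 _).resolve_left (sub_ne_zero.2 hne)
    linear_combination s (1, k) 1 * r2 - s (0, c) 1 * r3
  have q1 : w (1, c) = 0 := by
    apply (mul_eq_zero.1 _).resolve_left (sub_ne_zero.2 hne)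
    linear_combination s (0, c) 0 * r3 - s (1, k) 0 * r2
  apply hw
  ext ⟨a, b⟩
  by_cases hb : b = c
  · subst hb
    fin_cases a
    exacts [q0, q1]
  · obtain rfl : b = d := by omega
    rcases hjj' with ⟨rfl, rfl⟩ | ⟨rfl, rfl⟩ <;> fin_cases a <;> assumption

theorem onAB_onAC_onAB_ne_fredkin_mul_onAC (U W t : (Matrix Idx2 Idx2 ℂ)ˣ)
    (V : Matrix Idx2 Idx2 ℂ) : onAB U.val * onAC V * onAB W.val ≠ fredkin * onAC t.val := by
  intro h
  set s : (Fin 2 → ℂ) → Idx2 → Fin 2 → ℂ :=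
    fun γ x j => (t.val *ᵥ fun x => if x.1 = j then γ x.2 else 0) x with hs
  have hm (γ c k) : s γ (0, c) 0 * s γ (1, k) 1 = s γ (0, c) 1 * s γ (1, k) 0 :=
    minor_eq_zero_of_fredkin_mul_onAC U W h γ c k
  have hsx (γ x j) : s γ x j = t.val x (j, 0) * γ 0 + t.val x (j, 1) * γ 1 := by
    fin_cases j <;> simp [hs, Matrix.mulVec, dotProduct, Fintype.sum_prod_type]
  clear_value s
  have hadd (γ γ' x j) : s (γ + γ') x j = s γ x j + s γ' x j := by
    simp only [hsx, Pi.add_apply]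
    ring
  have hinj (w : Idx2 → ℂ) (hw : t.val *ᵥ w = 0) : w = 0 := by
    simpa using congrArg ((t⁻¹).val *ᵥ ·) hw
  have hker (γ : Fin 2 → ℂ) (hγ : γ ≠ 0) (u : Fin 2 → ℂ)
      (hu : ∀ x, s γ x 0 * u 0 + s γ x 1 * u 1 = 0) : u = 0 := by
    have h0 : (fun x : Idx2 => u x.1 * γ x.2) = 0 := by
      apply hinj
      ext x
      rw [Pi.zero_apply, ← hu x]
      simp only [hsx, Matrix.mulVec, dotProduct, Fintype.sum_prod_type, Fin.sum_univ_two]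
      ring
    obtain ⟨q, hq⟩ := Function.ne_iff.1 hγ
    ext p
    exact (mul_eq_zero.1 (congrFun h0 (p, q))).resolve_right hq
  -- If both halves of the 4 × 2 matrix `s γ` have a nonzero row, the minors make all rows parallel.
  -- Its rank is then one, against the injectivity of t on vectors u ⊗ γ.
  have hdich (γ : Fin 2 → ℂ) {c k j l : Fin 2} (h0 : s γ (0, c) j ≠ 0) (h1 : s γ (1, k) l ≠ 0) :
      False := by
    have hγ : γ ≠ 0 := by
      rintro rfl
      apply h0
      simp [hsx]
    have hk (k' : Fin 2) : s γ (1, k') 0 * s γ (1, k) 1 = s γ (1, k') 1 * s γ (1, k) 0 := by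
      have e1 := hm γ c k
      have e2 := hm γ c k'
      apply mul_left_cancel₀ h0
      fin_cases j
      · simp only [Fin.zero_eta]
        linear_combination s γ (1, k') 0 * e1 - s γ (1, k) 0 * e2
      · simp only [Fin.mk_one]
        linear_combination s γ (1, k') 1 * e1 - s γ (1, k) 1 * e2
    have := hker γ hγ ![s γ (1, k) 1, -s γ (1, k) 0] (by
      rintro ⟨a, b⟩
      simp only [Matrix.cons_val_zero, Matrix.cons_val_one]
      revert a
      refine Fin.forall_fin_two.2 ⟨?_, ?_⟩
      · linear_combination hm γ b k
      · linear_combination hk b)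
    have g0 : s γ (1, k) 1 = 0 := congrFun this 0
    have g1 : -s γ (1, k) 0 = 0 := congrFun this 1
    fin_cases l
    exacts [h1 (neg_eq_zero.1 g1), h1 g0]
  have hex (a : Fin 2) : ∃ γ b j, s γ (a, b) j ≠ 0 := by
    by_contra! hall
    have hrow (x) : t.val (a, 0) x = 0 := by
      obtain ⟨j, q⟩ := x
      rw [← hall (Pi.single q 1) 0 j, hsx]
      fin_cases q <;> simp
    have h1 := congrFun (congrFun t.mul_inv (a, 0)) (a, 0)
    rw [Matrix.mul_apply, Finset.sum_eq_zero (fun x _ => by rw [hrow, zero_mul]),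
      Matrix.one_apply_eq] at h1
    exact zero_ne_one h1
  obtain ⟨γ₀, c, j, h0⟩ := hex 0
  obtain ⟨γ₁, k, l, h1⟩ := hex 1
  have h01 : s γ₀ (1, k) l = 0 := by
    by_contra h'
    exact hdich γ₀ h0 h'
  have h10 : s γ₁ (0, c) j = 0 := by
    by_contra h'
    exact hdich γ₁ h' h1
  -- For every γ one half of `s γ` vanishes. By linearity the sum of two vectors with opposite
  -- nonvanishing halves has both halves nonzero.
  exact hdich (γ₀ + γ₁) (c := c) (j := j) (k := k) (l := l) (by rwa [hadd, h10, add_zero])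
    (by rwa [hadd, h01, zero_add])

/-! ### The word AB·AC·AB·BC: commutation and intertwining -/

/-- M = (k ⊗ 1)S is similar to e ⊗ 1, so it obeys the Cayley–Hamilton equation of e, while M² = k ⊗
k. Comparing entries, with tr k = 2 tr e, gives k = 0. The lemma kills the off-diagonal blocks in
the commutation argument for F·z_BC. -/
lemma eq_zero_of_mul_kronecker_one_eq (z : (Matrix Idx2 Idx2 ℂ)ˣ)
    (e k : Matrix (Fin 2) (Fin 2) ℂ)
    (h : z.val * (e ⊗ₖ 1) = ((k ⊗ₖ 1) * swapGate) * z.val) : e = 0 := by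
  set M := (k ⊗ₖ (1 : Matrix (Fin 2) (Fin 2) ℂ)) * swapGate with hM
  have hMa (b c b' c') : M (b, c) (b', c') = if c = b' then k b c' else 0 := by
    rw [hM, mul_swapGate_apply]
    simp [Matrix.one_apply]
  have hz : M = z.val * (e ⊗ₖ 1) * (z⁻¹).val := by rw [h]; simp [mul_assoc]
  have htr : k.trace = 2 * e.trace := by
    have : M.trace = k.trace := by
      simp [Matrix.trace, Fintype.sum_prod_type, hMa]
    rw [← this, hz, Matrix.trace_mul_comm, ← mul_assoc]
    simp [Matrix.trace_kronecker, mul_comm]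
  have he : e * e = e.trace • e - e.det • 1 := by
    ext i j
    fin_cases i <;> fin_cases j <;>
      simp [Matrix.mul_apply, Matrix.trace_fin_two, Matrix.det_fin_two] <;> ring
  have hMM : M * M = e.trace • M - e.det • 1 := by
    have : M * M = z.val * ((e * e) ⊗ₖ 1) * (z⁻¹).val := by
      rw [← one_mul (1 : Matrix (Fin 2) (Fin 2) ℂ), Matrix.mul_kronecker_mul, hz]
      simp only [mul_assoc]
      rw [← mul_assoc (z⁻¹).val, Units.inv_mul, one_mul]
    rw [this, he, hz, sub_eq_add_neg, ← neg_smul, Matrix.add_kronecker, Matrix.smul_kronecker,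
      Matrix.smul_kronecker, Matrix.one_kronecker_one]
    simp [mul_add, add_mul, sub_eq_add_neg]
  have q (b c b' c' : Fin 2) : k b b' * k c c' = e.trace * (if c = b' then k b c' else 0) -
      e.det * (if b = b' ∧ c = c' then 1 else 0) := by
    have := congrFun (congrFun hMM (b, c)) (b', c')
    rw [Matrix.mul_apply, Fintype.sum_prod_type] at this
    simpa [hMa, Matrix.one_apply] using this
  have k10 : k 1 0 = 0 := by simpa using q 1 1 0 0
  have k01 : k 0 1 = 0 := by simpa using q 0 0 1 1
  have a1 : k 0 0 * k 1 1 = -e.det := by simpa using q 0 1 0 1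
  have a2 : k 0 0 * k 0 0 = e.trace * k 0 0 - e.det := by simpa using q 0 0 0 0
  have a3 : k 1 1 * k 1 1 = e.trace * k 1 1 - e.det := by simpa using q 1 1 1 1
  have a4 : e.trace = 0 ∨ k 1 1 = 0 := by simpa [k10, k01, eq_comm] using q 1 0 0 1
  have a5 : e.trace = 0 ∨ k 0 0 = 0 := by simpa [k10, k01, eq_comm] using q 0 1 1 0
  rw [Matrix.trace_fin_two k] at htr
  have hk : k 0 0 = 0 ∧ k 1 1 = 0 := by
    rcases a4 with h0 | h1
    · rw [h0] at a2 a3 htr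
      have h2 : k 1 1 = -k 0 0 := by linear_combination htr
      rw [h2] at a1
      have h3 : k 0 0 * k 0 0 = 0 := by linear_combination (a2 - a1) / 2
      have h4 : k 0 0 = 0 := by simpa using h3
      simp [h2, h4]
    · rcases a5 with h0 | h0
      · rw [h1, h0] at htr
        exact ⟨by linear_combination htr, h1⟩
      · exact ⟨h0, h1⟩
  have hk0 : k = 0 := by
    ext i j
    fin_cases i <;> fin_cases j <;> simp [hk, k10, k01]
  have h0 : e ⊗ₖ (1 : Matrix (Fin 2) (Fin 2) ℂ) = 0 := by
    have := congrArg ((z⁻¹).val * ·) h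
    simpa [hM, hk0] using this
  ext i j
  simpa using congrFun (congrFun h0 (i, 0)) (j, 0)

/-- Two bilinear forms on `ℂ² × ℂ²` have a common zero with both entries nonzero. -/
lemma exists_common_zero (α β : Matrix (Fin 2) (Fin 2) ℂ) :
    ∃ δ γ : Fin 2 → ℂ, δ ≠ 0 ∧ γ ≠ 0 ∧ δ ⬝ᵥ (α *ᵥ γ) = 0 ∧ δ ⬝ᵥ (β *ᵥ γ) = 0 := by
  -- The vectors αγ and βγ are parallel exactly when a binary quadratic form in γ vanishes, and over
  -- ℂ it has a nontrivial zero. Then some δ annihilates both.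
  obtain ⟨γ, hγ, hdet⟩ : ∃ γ : Fin 2 → ℂ, γ ≠ 0 ∧
      (α *ᵥ γ) 0 * (β *ᵥ γ) 1 - (α *ᵥ γ) 1 * (β *ᵥ γ) 0 = 0 := by
    simp only [Matrix.mulVec, dotProduct, Fin.sum_univ_two]
    by_cases hA : α 0 0 * β 1 0 - α 1 0 * β 0 0 = 0
    · exact ⟨![1, 0], fun h => by simpa using congrFun h 0, by simpa using hA⟩
    · obtain ⟨x, hx⟩ := exists_quadratic_eq_zero
        (b := α 0 0 * β 1 1 + α 0 1 * β 1 0 - α 1 0 * β 0 1 - α 1 1 * β 0 0)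
        (c := α 0 1 * β 1 1 - α 1 1 * β 0 1) hA (IsAlgClosed.exists_eq_mul_self _)
      refine ⟨![x, 1], fun h => by simpa using congrFun h 1, ?_⟩
      simp only [Matrix.cons_val_zero, Matrix.cons_val_one]
      linear_combination hx
  obtain ⟨δ, hδ, h⟩ := Matrix.exists_vecMul_eq_zero_iff.2
    (show (Matrix.of fun i j => ![(α *ᵥ γ) i, (β *ᵥ γ) i] j).det = 0 by
      rw [Matrix.det_fin_two]
      simp only [Matrix.of_apply, Matrix.cons_val_zero, Matrix.cons_val_one]
      linear_combination hdet)
  refine ⟨δ, γ, hδ, hγ, ?_, ?_⟩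
  · simpa [Matrix.vecMul, dotProduct] using congrFun h 0
  · simpa [Matrix.vecMul, dotProduct] using congrFun h 1

/-- If all partial matrix elements of `V` intertwine `p` with `r`, and `p` is not a scalar, then
one of the partial matrix elements along product vectors vanishes. -/
lemma exists_partialC_eq_zero {V : Matrix Idx2 Idx2 ℂ} {p r : Matrix (Fin 2) (Fin 2) ℂ}
    (h : ∀ δ γ, partialC δ γ V * p = r * partialC δ γ V) (hp : ∀ x : ℂ, p ≠ x • 1) :
    ∃ δ γ : Fin 2 → ℂ, δ ≠ 0 ∧ γ ≠ 0 ∧ partialC δ γ V = 0 := by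
  -- A nonscalar p has a vector v independent of pv. A matrix element of V that kills v also kills
  -- pv by intertwining, hence vanishes.
  obtain ⟨v, hv⟩ : ∃ v : Fin 2 → ℂ, v 0 * (p *ᵥ v) 1 - v 1 * (p *ᵥ v) 0 ≠ 0 := by
    by_contra! hall
    simp only [Matrix.mulVec, dotProduct, Fin.sum_univ_two] at hall
    have h1 := hall ![1, 0]
    have h2 := hall ![0, 1]
    have h3 := hall ![1, 1]
    simp at h1 h2 h3
    apply hp (p 0 0)
    ext i j
    fin_cases i <;> fin_cases j <;> simp [h1, h2]
    linear_combination h3 - h1 + h2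
  obtain ⟨δ, γ, hδ, hγ, h0, h1⟩ := exists_common_zero
    (Matrix.of fun c c' => V (0, c) (0, c') * v 0 + V (0, c) (1, c') * v 1)
    (Matrix.of fun c c' => V (1, c) (0, c') * v 0 + V (1, c) (1, c') * v 1)
  refine ⟨δ, γ, hδ, hγ, ?_⟩
  have hav : partialC δ γ V *ᵥ v = 0 := by
    refine funext (Fin.forall_fin_two.2 ⟨?_, ?_⟩)
    · simp only [Matrix.mulVec, dotProduct, Fin.sum_univ_two, Matrix.of_apply] at h0
      simp only [Matrix.mulVec, dotProduct, Fin.sum_univ_two, partialC, Matrix.of_apply,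
        Pi.zero_apply]
      linear_combination h0
    · simp only [Matrix.mulVec, dotProduct, Fin.sum_univ_two, Matrix.of_apply] at h1
      simp only [Matrix.mulVec, dotProduct, Fin.sum_univ_two, partialC, Matrix.of_apply,
        Pi.zero_apply]
      linear_combination h1
  have hapv : partialC δ γ V *ᵥ (p *ᵥ v) = 0 := by
    rw [Matrix.mulVec_mulVec, h, ← Matrix.mulVec_mulVec, hav, Matrix.mulVec_zero]
  generalize partialC δ γ V = a at hav hapv
  generalize p *ᵥ v = u at hv hapv
  ext i j
  have e1 := congrFun hav i
  have e2 := congrFun hapv i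
  simp only [Matrix.mulVec, dotProduct, Fin.sum_univ_two, Pi.zero_apply] at e1 e2
  refine (mul_eq_zero.1 ?_).resolve_left hv
  revert j
  refine Fin.forall_fin_two.2 ⟨?_, ?_⟩
  · linear_combination u 1 * e1 - v 1 * e2
  · linear_combination v 0 * e2 - u 0 * e1

/-- The commutant of 1 ⊗ M₂ is M₂ ⊗ 1; commuting with the two off-diagonal matrix units already
forces this form. -/
lemma exists_kronecker_one_of_commute {P : Matrix Idx2 Idx2 ℂ}
    (h : ∀ n : Matrix (Fin 2) (Fin 2) ℂ, P * (1 ⊗ₖ n) = (1 ⊗ₖ n) * P) :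
    ∃ p : Matrix (Fin 2) (Fin 2) ℂ, P = p ⊗ₖ 1 := by
  refine ⟨Matrix.of fun a a' => P (a, 0) (a', 0), ?_⟩
  have e (n : Matrix (Fin 2) (Fin 2) ℂ) (a b a' b') : P (a, b) (a', 0) * n 0 b' +
      P (a, b) (a', 1) * n 1 b' = n b 0 * P (a, 0) (a', b') + n b 1 * P (a, 1) (a', b') := by
    have := congrFun (congrFun (h n) (a, b)) (a', b')
    simpa [Matrix.mul_apply, Fintype.sum_prod_type, Matrix.one_apply] using this
  ext ⟨a, b⟩ ⟨a', b'⟩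
  have e1 := e !![0, 1; 0, 0] a 1 a' 1
  have e2 := e !![0, 1; 0, 0] a 0 a' 1
  have e3 := e !![0, 0; 1, 0] a 0 a' 0
  simp at e1 e2 e3
  fin_cases b <;> fin_cases b' <;> simp [e1, e2, e3]

/-- The Pauli operator `Z` on the first qubit of a pair. -/
def pauliZ : Matrix Idx2 Idx2 ℂ := Matrix.diagonal ![1, -1] ⊗ₖ 1

lemma fredkin_mul_onBC (z : Matrix Idx2 Idx2 ℂ) :
    fredkin * onBC z = controlled ![z, swapGate * z] := by
  rw [fredkin_eq_controlled, onBC_eq_controlled, controlled_mul]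
  congr 1
  ext a : 1
  fin_cases a <;> simp

lemma onAB_pauliZ : onAB pauliZ = controlled ![1, -1] := by
  ext ⟨a, b, c⟩ ⟨a', b', c'⟩
  by_cases hb : b = b' <;> by_cases hc : c = c' <;>
  fin_cases a <;> fin_cases a' <;>
    simp [onAB, pauliZ, controlled_apply, Matrix.one_apply, hb, hc]

/-- The block of a two-qubit operator between the states `a` and `a'` of the first qubit. -/
def blockA (M : Matrix Idx2 Idx2 ℂ) (a a' : Fin 2) : Matrix (Fin 2) (Fin 2) ℂ :=
  Matrix.of fun b b' => M (a, b) (a', b')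

/-- The block of a two-qubit operator between the states `0` and `0` of the second qubit. -/
def blockB (M : Matrix Idx2 Idx2 ℂ) : Matrix (Fin 2) (Fin 2) ℂ :=
  Matrix.of fun a a' => M (a, 0) (a', 0)

lemma mul_blockA_of_controlled_mul_onAB {N : Fin 2 → Matrix Idx2 Idx2 ℂ}
    {M M' : Matrix Idx2 Idx2 ℂ} (h : controlled N * onAB M = onAB M' * controlled N)
    (a a' : Fin 2) : N a * (blockA M a a' ⊗ₖ 1) = (blockA M' a a' ⊗ₖ 1) * N a' := by
  ext ⟨b, c⟩ ⟨b', c'⟩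
  have := congrFun (congrFun h (a, b, c)) (a', b', c')
  simpa [Matrix.mul_apply, Fintype.sum_prod_type, onAB, controlled_apply, blockA,
    Matrix.one_apply, ite_and] using this

lemma onAB_one_kronecker_comm (n : Matrix (Fin 2) (Fin 2) ℂ) (V : Matrix Idx2 Idx2 ℂ) :
    onAB (1 ⊗ₖ n) * onAC V = onAC V * onAB (1 ⊗ₖ n) := by
  ext ⟨a, b, c⟩ ⟨a', b', c'⟩
  simp [Matrix.mul_apply, Fintype.sum_prod_type, onAB, onAC, Matrix.one_apply, mul_comm]

theorem onAB_onAC_onAB_ne_fredkin_mul_onBC (U W z : (Matrix Idx2 Idx2 ℂ)ˣ)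
    (V : Matrix Idx2 Idx2 ℂ) : onAB U.val * onAC V * onAB W.val ≠ fredkin * onBC z.val := by
  intro h
  set G := fredkin * onBC z.val with hG
  have hGc : G = controlled ![z.val, swapGate * z.val] := fredkin_mul_onBC _
  -- Since 1 ⊗ n on AB commutes with the AC gate, G carries a conjugate of it by W to a conjugate by
  -- U, both still acting on AB only.
  have hcomm (n : Matrix (Fin 2) (Fin 2) ℂ) :
      G * onAB ((W⁻¹).val * (1 ⊗ₖ n) * W.val) = onAB (U.val * (1 ⊗ₖ n) * (U⁻¹).val) * G := by
    rw [← h]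
    calc onAB U.val * onAC V * onAB W.val * onAB ((W⁻¹).val * (1 ⊗ₖ n) * W.val)
        = onAB U.val * onAC V * onAB (W.val * ((W⁻¹).val * (1 ⊗ₖ n) * W.val)) := by
          rw [mul_assoc, onAB_mul]
      _ = onAB U.val * (onAC V * onAB (1 ⊗ₖ n)) * onAB W.val := by
          simp [← mul_assoc, ← onAB_mul]
      _ = onAB (U.val * (1 ⊗ₖ n)) * onAC V * onAB W.val := by
          rw [← onAB_one_kronecker_comm, ← mul_assoc, onAB_mul]
      _ = onAB (U.val * (1 ⊗ₖ n) * (U⁻¹).val * U.val) * onAC V * onAB W.val := by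
          simp [mul_assoc]
      _ = _ := by rw [← onAB_mul _ U.val]; simp only [mul_assoc]
  let S : (Matrix Idx2 Idx2 ℂ)ˣ := ⟨swapGate, swapGate, swapGate_mul_self, swapGate_mul_self⟩
  have hblock (n : Matrix (Fin 2) (Fin 2) ℂ) :
      blockA ((W⁻¹).val * (1 ⊗ₖ n) * W.val) 0 1 = 0 ∧
      blockA ((W⁻¹).val * (1 ⊗ₖ n) * W.val) 1 0 = 0 := by
    have hb := mul_blockA_of_controlled_mul_onAB (hGc ▸ hcomm n)
    constructor
    · refine eq_zero_of_mul_kronecker_one_eq z _ (blockA (U.val * (1 ⊗ₖ n) * (U⁻¹).val) 0 1) ?_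
      rw [mul_assoc _ swapGate]
      exact hb 0 1
    · refine eq_zero_of_mul_kronecker_one_eq (S * z) _
        (blockA (U.val * (1 ⊗ₖ n) * (U⁻¹).val) 1 0) ?_
      rw [Units.val_mul, mul_assoc _ swapGate, ← mul_assoc swapGate S.val, swapGate_mul_self,
        one_mul]
      exact hb 1 0
  have hZ (n : Matrix (Fin 2) (Fin 2) ℂ) : pauliZ * ((W⁻¹).val * (1 ⊗ₖ n) * W.val) =
      ((W⁻¹).val * (1 ⊗ₖ n) * W.val) * pauliZ := by
    obtain ⟨h0, h1⟩ := hblock n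
    generalize (W⁻¹).val * (1 ⊗ₖ n) * W.val = M at h0 h1
    have h0' (b b') : M (0, b) (1, b') = 0 := congrFun (congrFun h0 b) b'
    have h1' (b b') : M (1, b) (0, b') = 0 := congrFun (congrFun h1 b) b'
    ext ⟨a, b⟩ ⟨a', b'⟩
    fin_cases a <;> fin_cases a' <;>
      simp [Matrix.mul_apply, Fintype.sum_prod_type, pauliZ, Matrix.one_apply, h0', h1']
  -- Block diagonality means commuting with Z on A, so W Z W⁻¹ lies in the commutant of all 1 ⊗ n.
  obtain ⟨p, hp⟩ := exists_kronecker_one_of_commute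
    (P := W.val * pauliZ * (W⁻¹).val) fun n => by
      have := congrArg (fun X => W.val * X * (W⁻¹).val) (hZ n)
      simpa [mul_assoc] using this
  have hps (x : ℂ) : p ≠ x • 1 := by
    rintro rfl
    rw [Matrix.smul_kronecker, Matrix.one_kronecker_one] at hp
    have hd : pauliZ = x • 1 := by
      have := congrArg (fun X => (W⁻¹).val * X * W.val) hp
      simpa [mul_assoc] using this
    have h0 := congrFun (congrFun hd (0, 0)) (0, 0)
    have h1 := congrFun (congrFun hd (1, 0)) (1, 0)
    simp [pauliZ] at h0 h1
    rw [← h0] at h1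
    norm_num at h1
  have hV : onAC V * onAB (p ⊗ₖ 1) = onAB ((U⁻¹).val * pauliZ * U.val) * onAC V := by
    have hc : onAB pauliZ * G = G * onAB pauliZ := by
      rw [hGc, onAB_pauliZ, controlled_mul, controlled_mul]
      congr 1
      ext a : 1
      fin_cases a <;> simp
    have hV : onAC V = onAB (U⁻¹).val * G * onAB (W⁻¹).val := by
      rw [← h]
      calc onAC V = onAB ((U⁻¹).val * U.val) * onAC V * onAB (W.val * (W⁻¹).val) := by
            simp [onAB_one]
        _ = _ := by simp only [← onAB_mul, mul_assoc]
    calc onAC V * onAB (p ⊗ₖ 1)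
        = onAB (U⁻¹).val * G * onAB ((W⁻¹).val * (W.val * pauliZ * (W⁻¹).val)) := by
          rw [hV, ← hp, mul_assoc, onAB_mul]
      _ = onAB (U⁻¹).val * (G * onAB pauliZ) * onAB (W⁻¹).val := by
          simp [← mul_assoc, ← onAB_mul]
      _ = onAB ((U⁻¹).val * pauliZ) * G * onAB (W⁻¹).val := by
          rw [← hc, ← onAB_mul]; simp only [mul_assoc]
      _ = onAB ((U⁻¹).val * pauliZ * U.val * (U⁻¹).val) * G * onAB (W⁻¹).val := by
          simp [mul_assoc]
      _ = _ := by rw [hV, ← onAB_mul _ (U⁻¹).val]; simp only [mul_assoc]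
  obtain ⟨δ, γ, hδ, hγ, hδγ⟩ := exists_partialC_eq_zero (V := V) (p := p)
    (r := blockB ((U⁻¹).val * pauliZ * U.val)) (fun δ γ => by
      have := congrArg (sliceC δ γ) hV
      rw [sliceC_mul_onAB, sliceC_onAB_mul, sliceC_onAC] at this
      ext a a'
      have := congrFun (congrFun this (a, 0)) (a', 0)
      simpa [Matrix.mul_apply, Fintype.sum_prod_type, Matrix.one_apply, blockB] using this) hps
  have hs : sliceC δ γ G = 0 := by
    rw [← h, sliceC_mul_onAB, sliceC_onAB_mul, sliceC_onAC, hδγ]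
    simp
  have e0 (b b') : δ 0 * (z.val (b, 0) (b', 0) * γ 0 + z.val (b, 0) (b', 1) * γ 1) +
      δ 1 * (z.val (b, 1) (b', 0) * γ 0 + z.val (b, 1) (b', 1) * γ 1) = 0 := by
    have := congrFun (congrFun hs (0, b)) (0, b')
    rw [hGc] at this
    simp [sliceC, controlled_apply] at this
    linear_combination this
  have e1 (b b') : δ 0 * (z.val (0, b) (b', 0) * γ 0 + z.val (0, b) (b', 1) * γ 1) +
      δ 1 * (z.val (1, b) (b', 0) * γ 0 + z.val (1, b) (b', 1) * γ 1) = 0 := by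
    have := congrFun (congrFun hs (1, b)) (1, b')
    rw [hGc] at this
    simp [sliceC, controlled_apply, swapGate_mul_apply] at this
    linear_combination this
  obtain ⟨j, hj⟩ := Function.ne_iff.1 hδ
  obtain ⟨j', hj'⟩ : ∃ j' : Fin 2, j' ≠ j := exists_ne j
  set ζ : Idx2 → Fin 2 → ℂ :=
    fun x b' => z.val x (b', 0) * γ 0 + z.val x (b', 1) * γ 1 with hζ
  -- By `e0` and `e1`, z(μ ⊗ γ) is annihilated by δ in either tensor factor. Such vectors form a
  -- line with coordinate (j', j'), so some μ ≠ 0 makes this coordinate, and hence the whole vector,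
  -- zero.
  obtain ⟨μ, hμ, hμj⟩ := exists_ne_zero_mul_add_mul_eq_zero (ζ (j', j') 0) (ζ (j', j') 1)
  have hζμ (x : Idx2) : ζ x 0 * μ 0 + ζ x 1 * μ 1 = 0 := by
    set κ : Idx2 → ℂ := fun x => ζ x 0 * μ 0 + ζ x 1 * μ 1 with hκ
    change κ x = 0
    have f0 (b : Fin 2) : δ 0 * κ (b, 0) + δ 1 * κ (b, 1) = 0 := by
      linear_combination μ 0 * e0 b 0 + μ 1 * e0 b 1
    have f1 (b : Fin 2) : δ 0 * κ (0, b) + δ 1 * κ (1, b) = 0 := by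
      linear_combination μ 0 * e1 b 0 + μ 1 * e1 b 1
    have f2 : κ (j', j') = 0 := hμj
    clear_value κ
    have hδj {y : ℂ} (hy : δ j * y = 0) : y = 0 := (mul_eq_zero.1 hy).resolve_left hj
    obtain ⟨b, c⟩ := x
    obtain ⟨rfl, rfl⟩ | ⟨rfl, rfl⟩ : j = 0 ∧ j' = 1 ∨ j = 1 ∧ j' = 0 := by omega
    · have g0 := hδj (y := κ (1, 0)) (by linear_combination f0 1 - δ 1 * f2)
      have g1 := hδj (y := κ (0, 1)) (by linear_combination f1 1 - δ 1 * f2)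
      have g2 := hδj (y := κ (0, 0)) (by linear_combination f0 0 - δ 1 * g1)
      fin_cases b <;> fin_cases c <;> assumption
    · have g0 := hδj (y := κ (0, 1)) (by linear_combination f0 0 - δ 0 * f2)
      have g1 := hδj (y := κ (1, 0)) (by linear_combination f1 0 - δ 0 * f2)
      have g2 := hδj (y := κ (1, 1)) (by linear_combination f0 1 - δ 0 * g1)
      fin_cases b <;> fin_cases c <;> assumption
  have h0 : z.val *ᵥ (fun x => μ x.1 * γ x.2) = 0 := by
    ext x
    rw [Pi.zero_apply, ← hζμ x]
    simp only [hζ, Matrix.mulVec, dotProduct, Fintype.sum_prod_type, Fin.sum_univ_two]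
    ring
  have h1 : (fun x : Idx2 => μ x.1 * γ x.2) = 0 := by
    simpa using congrArg ((z⁻¹).val *ᵥ ·) h0
  obtain ⟨a, ha⟩ := Function.ne_iff.1 hμ
  obtain ⟨c, hc⟩ := Function.ne_iff.1 hγ
  exact mul_ne_zero ha hc (congrFun h1 (a, c))

/-! ### A circuit of five gates -/

/-- The controlled gate `|0⟩⟨0| ⊗ I + |1⟩⟨1| ⊗ u` on two qubits. -/
def cgate (u : Matrix (Fin 2) (Fin 2) ℂ) : Matrix Idx2 Idx2 ℂ :=
  Matrix.of fun (a, b) (a', b') => if a = a' then (![1, u] a) b b' else 0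

lemma cgate_apply (u : Matrix (Fin 2) (Fin 2) ℂ) (a b a' b' : Fin 2) :
    cgate u (a, b) (a', b') = if a = a' then (![1, u] a) b b' else 0 := rfl

lemma cgate_mul (u v : Matrix (Fin 2) (Fin 2) ℂ) : cgate u * cgate v = cgate (u * v) := by
  ext ⟨a, b⟩ ⟨a', b'⟩
  fin_cases a <;> fin_cases a' <;>
    simp [Matrix.mul_apply, Fintype.sum_prod_type, cgate_apply, Matrix.one_apply]

lemma cgate_one : cgate 1 = 1 := by
  ext ⟨a, b⟩ ⟨a', b'⟩
  fin_cases a <;> fin_cases a' <;> simp [cgate_apply, Matrix.one_apply]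

lemma star_cgate (u : Matrix (Fin 2) (Fin 2) ℂ) : star (cgate u) = cgate (star u) := by
  ext ⟨a, b⟩ ⟨a', b'⟩
  fin_cases a <;> fin_cases a' <;>
    simp [cgate_apply, Matrix.star_apply, Matrix.one_apply, apply_ite, eq_comm]

lemma cgate_mem {u : Matrix (Fin 2) (Fin 2) ℂ} (hu : u ∈ Matrix.unitaryGroup (Fin 2) ℂ) :
    cgate u ∈ Matrix.unitaryGroup Idx2 ℂ := by
  rw [Matrix.mem_unitaryGroup_iff] at hu ⊢
  rw [star_cgate, cgate_mul, hu, cgate_one]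

/-- The Pauli operator `X`. -/
def pauliX : Matrix (Fin 2) (Fin 2) ℂ := !![0, 1; 1, 0]

/-- A square root of the Pauli operator `X`. -/
noncomputable def sqrtX : Matrix (Fin 2) (Fin 2) ℂ :=
  !![(1 + Complex.I) / 2, (1 - Complex.I) / 2; (1 - Complex.I) / 2, (1 + Complex.I) / 2]

lemma sqrtX_mul_self : sqrtX * sqrtX = pauliX := by
  ext i j
  fin_cases i <;> fin_cases j <;> simp [sqrtX, pauliX, Matrix.mul_apply] <;> ring_nf <;> simp <;> norm_num

lemma sqrtX_mul_star : sqrtX * star sqrtX = 1 := by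
  ext i j
  fin_cases i <;> fin_cases j <;>
    simp [sqrtX, Matrix.mul_apply, Matrix.star_apply, map_ofNat] <;> ring_nf <;> simp <;> norm_num

lemma sqrtX_mem : sqrtX ∈ Matrix.unitaryGroup (Fin 2) ℂ :=
  Matrix.mem_unitaryGroup_iff.2 sqrtX_mul_star

lemma star_pauliX : star pauliX = pauliX := by
  ext i j
  fin_cases i <;> fin_cases j <;> simp [pauliX, Matrix.star_apply]

lemma pauliX_mul_self : pauliX * pauliX = 1 := by
  ext i j
  fin_cases i <;> fin_cases j <;> simp [pauliX, Matrix.mul_apply]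

lemma pauliX_mem : pauliX ∈ Matrix.unitaryGroup (Fin 2) ℂ := by
  rw [Matrix.mem_unitaryGroup_iff, star_pauliX, pauliX_mul_self]

/-- The CNOT gate whose control is the second qubit. -/
def reverseCNOT : Matrix Idx2 Idx2 ℂ := swapGate * cgate pauliX * swapGate

lemma reverseCNOT_apply (a b a' b' : Fin 2) :
    reverseCNOT (a, b) (a', b') = cgate pauliX (b, a) (b', a') := by
  rw [reverseCNOT, mul_swapGate_apply, swapGate_mul_apply]
  rfl

lemma reverseCNOT_mem : reverseCNOT ∈ Matrix.unitaryGroup Idx2 ℂ :=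
  mul_mem (mul_mem swapGate_mem (cgate_mem pauliX_mem)) swapGate_mem

lemma reverseCNOT_mul_self : reverseCNOT * reverseCNOT = 1 := by
  have h : cgate pauliX * cgate pauliX = 1 := by rw [cgate_mul, pauliX_mul_self, cgate_one]
  calc reverseCNOT * reverseCNOT
      = swapGate * cgate pauliX * (swapGate * swapGate) * cgate pauliX * swapGate := by
        simp only [reverseCNOT, mul_assoc]
    _ = swapGate * (cgate pauliX * cgate pauliX) * swapGate := by
        rw [swapGate_mul_self, mul_one, mul_assoc swapGate]
    _ = 1 := by rw [h, mul_one, swapGate_mul_self]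

lemma reverseCNOT_comm : reverseCNOT * (pauliX ⊗ₖ 1) = (pauliX ⊗ₖ 1) * reverseCNOT := by
  ext ⟨a, b⟩ ⟨a', b'⟩
  fin_cases b <;> fin_cases b' <;>
    simp [Matrix.mul_apply, Fintype.sum_prod_type, reverseCNOT_apply, cgate_apply,
      Matrix.one_apply, mul_comm]

lemma reverseCNOT_cgate : reverseCNOT * cgate pauliX * reverseCNOT = swapGate := by
  ext ⟨a, b⟩ ⟨a', b'⟩
  fin_cases a <;> fin_cases b <;> fin_cases a' <;> fin_cases b' <;>
    simp [Matrix.mul_apply, Fintype.sum_prod_type, reverseCNOT_apply, cgate_apply, pauliX,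
      swapGate_apply]

/-- With V² = X, the control value 0 leaves V V* = 1 and the value 1 leaves V² = X. -/
lemma cgate_sqrtX_mul : cgate sqrtX * (1 ⊗ₖ sqrtX) * (pauliX ⊗ₖ 1) * cgate (star sqrtX) *
    (pauliX ⊗ₖ 1) = cgate pauliX := by
  have h1 : cgate sqrtX * (1 ⊗ₖ sqrtX) =
      Matrix.of fun x y => if x.1 = y.1 then (![sqrtX, pauliX] x.1) x.2 y.2 else 0 := by
    rw [← sqrtX_mul_self]
    ext ⟨a, b⟩ ⟨a', b'⟩
    fin_cases a <;> fin_cases a' <;> fin_cases b <;>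
      simp [Matrix.mul_apply, Fintype.sum_prod_type, cgate_apply, Matrix.one_apply]
  have h2 : (pauliX ⊗ₖ 1) * cgate (star sqrtX) * (pauliX ⊗ₖ 1) =
      Matrix.of fun x y => if x.1 = y.1 then (![star sqrtX, 1] x.1) x.2 y.2 else 0 := by
    ext ⟨a, b⟩ ⟨a', b'⟩
    fin_cases a <;> fin_cases a' <;>
      simp [Matrix.mul_apply, Fintype.sum_prod_type, cgate_apply, Matrix.one_apply, pauliX]
  rw [h1, mul_assoc, mul_assoc, ← mul_assoc (pauliX ⊗ₖ 1), h2]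
  ext ⟨a, b⟩ ⟨a', b'⟩
  have h3 := congrFun (congrFun sqrtX_mul_star b) b'
  simp only [Matrix.mul_apply, Fin.sum_univ_two, Matrix.star_apply] at h3
  fin_cases a <;> fin_cases a'
  · simpa [Matrix.mul_apply, Fintype.sum_prod_type, cgate_apply] using h3
  · simp [Matrix.mul_apply, Fintype.sum_prod_type, cgate_apply]
  · simp [Matrix.mul_apply, Fintype.sum_prod_type, cgate_apply]
  · fin_cases b' <;> simp [Matrix.mul_apply, Fintype.sum_prod_type, cgate_apply]

lemma onAB_cgate (u : Matrix (Fin 2) (Fin 2) ℂ) :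
    onAB (cgate u) = controlled ![1, u ⊗ₖ 1] := by
  ext ⟨a, b, c⟩ ⟨a', b', c'⟩
  fin_cases a <;> fin_cases a' <;>
    simp [onAB, cgate_apply, controlled_apply, Matrix.one_apply, ← ite_and, and_comm]

lemma onAC_cgate (u : Matrix (Fin 2) (Fin 2) ℂ) :
    onAC (cgate u) = controlled ![1, 1 ⊗ₖ u] := by
  ext ⟨a, b, c⟩ ⟨a', b', c'⟩
  fin_cases a <;> fin_cases a' <;>
    simp [onAC, cgate_apply, controlled_apply, Matrix.one_apply, ← ite_and, and_comm]

/-- For A = 0 the gates on BC cancel. For A = 1 the last CNOT commutes with X on its target B, so it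
moves to the end, and CNOTs in alternating directions give S. -/
theorem implementableBy_five_fredkin : ImplementableBy 5 fredkin := by
  refine ⟨![onBC (reverseCNOT * cgate sqrtX), onAC (cgate sqrtX), onAB (cgate pauliX),
    onBC (cgate (star sqrtX) * reverseCNOT), onAB (cgate pauliX)], ?_, ?_⟩
  · have hX := cgate_mem pauliX_mem
    have hV := cgate_mem sqrtX_mem
    have hV' : cgate (star sqrtX) ∈ Matrix.unitaryGroup Idx2 ℂ :=
      cgate_mem (Unitary.star_mem sqrtX_mem)
    intro i
    fin_cases i
    exacts [.inr (.inr ⟨_, mul_mem reverseCNOT_mem hV, rfl⟩), .inr (.inl ⟨_, hV, rfl⟩),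
      .inl ⟨_, hX, rfl⟩, .inr (.inr ⟨_, mul_mem hV' reverseCNOT_mem, rfl⟩), .inl ⟨_, hX, rfl⟩]
  · simp only [List.ofFn_succ, List.ofFn_zero, List.prod_cons, List.prod_nil, mul_one]
    simp only [Matrix.cons_val_zero, Matrix.cons_val_succ, onAB_cgate, onAC_cgate,
      onBC_eq_controlled, controlled_mul]
    rw [fredkin_eq_controlled]
    congr 1
    refine funext (Fin.forall_fin_two.2 ⟨?_, ?_⟩)
    · simp only [Matrix.cons_val_zero, mul_one, one_mul]
      rw [mul_assoc, ← mul_assoc (cgate sqrtX), cgate_mul, sqrtX_mul_star, cgate_one, one_mul,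
        reverseCNOT_mul_self]
    · simp only [Matrix.cons_val_one, Matrix.cons_val_zero]
      rw [← reverseCNOT_cgate, ← cgate_sqrtX_mul]
      simp only [mul_assoc, reverseCNOT_comm]

/-! ### Symmetries of four-gate words -/

/-- The class of two-qubit gates on one of the pairs `AB`, `AC`, `BC`. -/
def pairGates : Fin 3 → Set (Matrix Idx3 Idx3 ℂ) := ![KAB, KAC, KBC]

lemma isTwoQubitGate_iff {G : Matrix Idx3 Idx3 ℂ} :
    IsTwoQubitGate G ↔ ∃ p, G ∈ pairGates p := by
  simp [Fin.exists_fin_succ, pairGates, IsTwoQubitGate]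

lemma one_mem_pairGates : ∀ p, 1 ∈ pairGates p := by
  simp only [Fin.forall_fin_succ, IsEmpty.forall_iff, and_true]
  exact ⟨⟨1, one_mem _, onAB_one.symm⟩, ⟨1, one_mem _, onAC_one.symm⟩,
    ⟨1, one_mem _, onBC_one.symm⟩⟩

lemma mul_mem_pairGates : ∀ p, ∀ G ∈ pairGates p, ∀ H ∈ pairGates p, G * H ∈ pairGates p := by
  simp only [Fin.forall_fin_succ, IsEmpty.forall_iff, and_true]
  refine ⟨?_, ?_, ?_⟩
  · rintro _ ⟨U, hU, rfl⟩ _ ⟨V, hV, rfl⟩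
    exact ⟨_, mul_mem hU hV, onAB_mul _ _⟩
  · rintro _ ⟨U, hU, rfl⟩ _ ⟨V, hV, rfl⟩
    exact ⟨_, mul_mem hU hV, onAC_mul _ _⟩
  · rintro _ ⟨U, hU, rfl⟩ _ ⟨V, hV, rfl⟩
    exact ⟨_, mul_mem hU hV, onBC_mul _ _⟩

lemma star_mem_pairGates : ∀ p, ∀ G ∈ pairGates p, star G ∈ pairGates p := by
  simp only [Fin.forall_fin_succ, IsEmpty.forall_iff, and_true]
  refine ⟨?_, ?_, ?_⟩
  · rintro _ ⟨U, hU, rfl⟩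
    exact ⟨_, Unitary.star_mem hU, star_onAB _⟩
  · rintro _ ⟨U, hU, rfl⟩
    exact ⟨_, Unitary.star_mem hU, star_onAC _⟩
  · rintro _ ⟨U, hU, rfl⟩
    exact ⟨_, Unitary.star_mem hU, star_onBC _⟩

lemma conjBC_mem_pairGates :
    ∀ p, ∀ G ∈ pairGates p, conjBC G ∈ pairGates (Equiv.swap 0 1 p) := by
  simp only [Fin.forall_fin_succ, IsEmpty.forall_iff, and_true]
  refine ⟨?_, ?_, ?_⟩
  · rintro _ ⟨U, hU, rfl⟩
    exact ⟨_, hU, rfl⟩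
  · rintro _ ⟨U, hU, rfl⟩
    exact ⟨_, hU, rfl⟩
  · rintro _ ⟨U, hU, rfl⟩
    exact ⟨_, mul_mem (mul_mem swapGate_mem hU) swapGate_mem, conjBC_onBC U⟩

lemma onAC_swapGate_onAB (V : Matrix Idx2 Idx2 ℂ) :
    onAC swapGate * onAB V * onAC swapGate = onBC (swapGate * V * swapGate) := by
  rw [← conjBC_onBC, ← onAB_swapGate_onBC, conjBC_mul, conjBC_mul]
  rfl

/-- Conjugation by the swap on the pair `p` exchanges the other two pairs. -/
lemma exists_swap_pairGates : ∀ p q r : Fin 3, p ≠ q → p ≠ r → q ≠ r →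
    ∃ w ∈ pairGates p, w * w = 1 ∧ ∀ G ∈ pairGates q, w * G * w ∈ pairGates r := by
  have hAB : onAB swapGate * onAB swapGate = 1 := by rw [onAB_mul, swapGate_mul_self, onAB_one]
  have hAC : onAC swapGate * onAC swapGate = 1 := by rw [onAC_mul, swapGate_mul_self, onAC_one]
  have hBC : onBC swapGate * onBC swapGate = 1 := by rw [onBC_mul, swapGate_mul_self, onBC_one]
  have undo {w G H : Matrix Idx3 Idx3 ℂ} (hw : w * w = 1) (h : w * G * w = H) :
      w * H * w = G := by
    rw [← h]
    calc w * (w * G * w) * w = (w * w) * G * (w * w) := by simp only [mul_assoc]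
      _ = G := by rw [hw, one_mul, mul_one]
  intro p q r hpq hpr hqr
  fin_cases p <;> fin_cases q <;> fin_cases r <;>
    first
    | exact absurd rfl hpq
    | exact absurd rfl hpr
    | exact absurd rfl hqr
    | skip
  · refine ⟨_, ⟨_, swapGate_mem, rfl⟩, hAB, ?_⟩
    rintro _ ⟨V, hV, rfl⟩
    exact ⟨V, hV, onAB_swapGate_onBC V⟩
  · refine ⟨_, ⟨_, swapGate_mem, rfl⟩, hAB, ?_⟩
    rintro _ ⟨V, hV, rfl⟩
    exact ⟨V, hV, undo hAB (onAB_swapGate_onBC V)⟩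
  · refine ⟨_, ⟨_, swapGate_mem, rfl⟩, hAC, ?_⟩
    rintro _ ⟨V, hV, rfl⟩
    exact ⟨_, mul_mem (mul_mem swapGate_mem hV) swapGate_mem, onAC_swapGate_onAB V⟩
  · refine ⟨_, ⟨_, swapGate_mem, rfl⟩, hAC, ?_⟩
    rintro _ ⟨V, hV, rfl⟩
    refine ⟨_, mul_mem (mul_mem swapGate_mem hV) swapGate_mem, undo hAC ?_⟩
    rw [onAC_swapGate_onAB]
    congr 1
    rw [← mul_assoc, ← mul_assoc, swapGate_mul_self, one_mul, mul_assoc, swapGate_mul_self,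
      mul_one]
  · refine ⟨_, ⟨_, swapGate_mem, rfl⟩, hBC, ?_⟩
    rintro _ ⟨V, hV, rfl⟩
    exact ⟨V, hV, onBC_swapGate_mul _⟩
  · refine ⟨_, ⟨_, swapGate_mem, rfl⟩, hBC, ?_⟩
    rintro _ ⟨V, hV, rfl⟩
    exact ⟨V, hV, onBC_swapGate_mul _⟩

/-- The Fredkin gate is a product of four two-qubit gates on the given pairs. -/
def FredkinWord (p q r s : Fin 3) : Prop :=
  ∃ G₁ ∈ pairGates p, ∃ G₂ ∈ pairGates q, ∃ G₃ ∈ pairGates r, ∃ G₄ ∈ pairGates s,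
    G₁ * G₂ * G₃ * G₄ = fredkin

namespace FredkinWord

variable {p q r s : Fin 3}

lemma reverse (h : FredkinWord p q r s) : FredkinWord s r q p := by
  obtain ⟨G₁, h₁, G₂, h₂, G₃, h₃, G₄, h₄, h⟩ := h
  refine ⟨_, star_mem_pairGates _ _ h₄, _, star_mem_pairGates _ _ h₃, _,
    star_mem_pairGates _ _ h₂, _, star_mem_pairGates _ _ h₁, ?_⟩
  rw [← star_fredkin, ← h]
  simp only [star_mul, mul_assoc]

lemma exchange (h : FredkinWord p q r s) :
    FredkinWord (Equiv.swap 0 1 p) (Equiv.swap 0 1 q) (Equiv.swap 0 1 r) (Equiv.swap 0 1 s) := by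
  obtain ⟨G₁, h₁, G₂, h₂, G₃, h₃, G₄, h₄, h⟩ := h
  refine ⟨_, conjBC_mem_pairGates _ _ h₁, _, conjBC_mem_pairGates _ _ h₂, _,
    conjBC_mem_pairGates _ _ h₃, _, conjBC_mem_pairGates _ _ h₄, ?_⟩
  rw [← conjBC_mul, ← conjBC_mul, ← conjBC_mul, h, conjBC_fredkin]

/-- Inserting the square of the swap on p on both sides of the second gate moves that gate from q to
r; the outer swaps are absorbed by its neighbours. -/
lemma change_second (h : FredkinWord p q p s) (hpq : p ≠ q) (r : Fin 3) (hpr : p ≠ r) :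
    FredkinWord p r p s := by
  by_cases hqr : q = r
  · exact hqr ▸ h
  obtain ⟨G₁, h₁, G₂, h₂, G₃, h₃, G₄, h₄, h⟩ := h
  obtain ⟨w, hw, hww, hG⟩ := exists_swap_pairGates p q r hpq hpr hqr
  refine ⟨G₁ * w, mul_mem_pairGates _ _ h₁ _ hw, w * G₂ * w, hG _ h₂, w * G₃,
    mul_mem_pairGates _ _ hw _ h₃, G₄, h₄, ?_⟩
  calc G₁ * w * (w * G₂ * w) * (w * G₃) * G₄
      = G₁ * (w * w) * G₂ * (w * w) * G₃ * G₄ := by simp only [mul_assoc]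
    _ = fredkin := by rw [hww, mul_one, mul_one, h]

lemma split_first (h : FredkinWord p p r s) (q : Fin 3) : FredkinWord p q r s := by
  obtain ⟨G₁, h₁, G₂, h₂, G₃, h₃, G₄, h₄, h⟩ := h
  exact ⟨_, mul_mem_pairGates _ _ h₁ _ h₂, 1, one_mem_pairGates _, G₃, h₃, G₄, h₄,
    by rw [mul_one, h]⟩

lemma split_second (h : FredkinWord p q q s) (r : Fin 3) : FredkinWord p q r s := by
  obtain ⟨G₁, h₁, G₂, h₂, G₃, h₃, G₄, h₄, h⟩ := h
  exact ⟨G₁, h₁, _, mul_mem_pairGates _ _ h₂ _ h₃, 1, one_mem_pairGates _, G₄, h₄,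
    by rw [mul_one, ← mul_assoc, h]⟩

lemma split_third (h : FredkinWord p q r r) (s : Fin 3) : FredkinWord p q r s := by
  obtain ⟨G₁, h₁, G₂, h₂, G₃, h₃, G₄, h₄, h⟩ := h
  exact ⟨G₁, h₁, G₂, h₂, _, mul_mem_pairGates _ _ h₃ _ h₄, 1, one_mem_pairGates _,
    by rw [mul_one, ← mul_assoc, h]⟩

/-- The gate `X` on the qubit `A` exchanges the Fredkin gate and its product with the swap. -/
lemma exchange_last (h : FredkinWord 0 1 2 0) : FredkinWord 0 1 2 1 := by
  obtain ⟨G₁, ⟨U, hU, rfl⟩, G₂, h₂, _, ⟨W, hW, rfl⟩, _, ⟨T, hT, rfl⟩, h⟩ := h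
  have hX : pauliX ⊗ₖ (1 : Matrix (Fin 2) (Fin 2) ℂ) ∈ Matrix.unitaryGroup Idx2 ℂ :=
    Matrix.kronecker_mem_unitary pauliX_mem (one_mem _)
  refine ⟨_, ⟨_, mul_mem hX hU, rfl⟩, G₂, h₂, _, ⟨_, mul_mem hW swapGate_mem, rfl⟩, _,
    ⟨_, mul_mem hT hX, rfl⟩, ?_⟩
  -- X on A alone counts as a gate on AB and as one on AC, so it can be absorbed at either end of
  -- the new word.
  have hXX : onAB (pauliX ⊗ₖ 1) = onAC (pauliX ⊗ₖ 1) := by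
    ext ⟨a, b, c⟩ ⟨a', b', c'⟩
    by_cases hb : b = b' <;> by_cases hc : c = c' <;>
      simp [onAB, onAC, Matrix.one_apply, hb, hc]
  have hF : onAB (pauliX ⊗ₖ 1) * (fredkin * onBC swapGate) * onAB (pauliX ⊗ₖ 1) = fredkin := by
    rw [fredkin_mul_onBC, swapGate_mul_self, fredkin_eq_controlled]
    ext ⟨a, b, c⟩ ⟨a', b', c'⟩
    fin_cases a <;> fin_cases a' <;>
      simp [Matrix.mul_apply, Fintype.sum_prod_type, onAB, controlled_apply, pauliX,
        Matrix.one_apply]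
  calc onAB ((pauliX ⊗ₖ 1) * U) * G₂ * onBC (W * swapGate) * onAC (T * (pauliX ⊗ₖ 1))
      = onAB (pauliX ⊗ₖ 1) * (onAB U * G₂ * onBC W * onBC swapGate * onAC T) *
          onAB (pauliX ⊗ₖ 1) := by
        rw [← onAB_mul, ← onBC_mul, ← onAC_mul, hXX]
        simp only [mul_assoc]
    _ = onAB (pauliX ⊗ₖ 1) * (onAB U * G₂ * onBC W *
          (onBC swapGate * onAC T * onBC swapGate) * onBC swapGate) * onAB (pauliX ⊗ₖ 1) := by
        have : onBC swapGate * onBC swapGate = 1 := by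
          rw [onBC_mul, swapGate_mul_self, onBC_one]
        simp only [mul_assoc, this, mul_one]
    _ = onAB (pauliX ⊗ₖ 1) * (fredkin * onBC swapGate) * onAB (pauliX ⊗ₖ 1) := by
        rw [onBC_swapGate_mul, conjBC_onAC, h]
    _ = fredkin := hF

/-! ### Elimination of all words and minimality -/

lemma not_0101 : ¬ FredkinWord 0 1 0 1 := by
  rintro ⟨_, ⟨U, hU, rfl⟩, _, ⟨V, hV, rfl⟩, _, ⟨W, hW, rfl⟩, _, ⟨T, hT, rfl⟩, h⟩
  refine onAB_onAC_onAB_ne_fredkin_mul_onAC (Unitary.toUnits ⟨U, hU⟩) (Unitary.toUnits ⟨W, hW⟩)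
    (Unitary.toUnits ⟨T, hT⟩)⁻¹ V ?_
  rw [← h, mul_assoc _ _ (onAC _), onAC_mul,
    show T * ((Unitary.toUnits ⟨T, hT⟩)⁻¹).val = 1 from Units.mul_inv (Unitary.toUnits ⟨T, hT⟩),
    onAC_one, mul_one]
  rfl

lemma not_0102 : ¬ FredkinWord 0 1 0 2 := by
  rintro ⟨_, ⟨U, hU, rfl⟩, _, ⟨V, hV, rfl⟩, _, ⟨W, hW, rfl⟩, _, ⟨T, hT, rfl⟩, h⟩
  refine onAB_onAC_onAB_ne_fredkin_mul_onBC (Unitary.toUnits ⟨U, hU⟩) (Unitary.toUnits ⟨W, hW⟩)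
    (Unitary.toUnits ⟨T, hT⟩)⁻¹ V ?_
  rw [← h, mul_assoc _ _ (onBC _), onBC_mul,
    show T * ((Unitary.toUnits ⟨T, hT⟩)⁻¹).val = 1 from Units.mul_inv (Unitary.toUnits ⟨T, hT⟩),
    onBC_one, mul_one]
  rfl

lemma not_2012 : ¬ FredkinWord 2 0 1 2 := by
  rintro ⟨_, ⟨U, hU, rfl⟩, _, ⟨V, hV, rfl⟩, _, ⟨W, hW, rfl⟩, _, ⟨T, hT, rfl⟩, h⟩
  exact onBC_onAB_onAC_onBC_ne_fredkin (Unitary.toUnits ⟨U, hU⟩) (Unitary.toUnits ⟨T, hT⟩) V W h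

lemma not_zero (hq : 0 ≠ q) (hqr : q ≠ r) (hrs : r ≠ s) : ¬ FredkinWord 0 q r s := by
  have h1010 : ¬ FredkinWord 1 0 1 0 := fun h => not_0101 h.exchange
  have h0202 : ¬ FredkinWord 0 2 0 2 := fun h =>
    not_0102 (h.change_second (by decide) 1 (by decide))
  have h0121 : ¬ FredkinWord 0 1 2 1 := fun h =>
    h1010 (h.reverse.change_second (by decide) 0 (by decide))
  have h0120 : ¬ FredkinWord 0 1 2 0 := fun h => h0121 h.exchange_last
  have h0201 : ¬ FredkinWord 0 2 0 1 := fun h =>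
    not_0101 (h.change_second (by decide) 1 (by decide))
  have h0210 : ¬ FredkinWord 0 2 1 0 := fun h => h0120 h.reverse
  have h0212 : ¬ FredkinWord 0 2 1 2 := fun h =>
    h0202 (h.reverse.change_second (by decide) 0 (by decide)).reverse
  have h0101 := not_0101
  have h0102 := not_0102
  fin_cases q <;> fin_cases r <;> fin_cases s <;> first | assumption | contradiction

lemma not_one (hq : 1 ≠ q) (hqr : q ≠ r) (hrs : r ≠ s) : ¬ FredkinWord 1 q r s := fun h =>
  not_zero (fun h' => hq ((Equiv.swap (0 : Fin 3) 1).injective (by simpa using h')))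
    ((Equiv.swap (0 : Fin 3) 1).injective.ne hqr) ((Equiv.swap (0 : Fin 3) 1).injective.ne hrs)
    h.exchange

lemma not_of_ne (hpq : p ≠ q) (hqr : q ≠ r) (hrs : r ≠ s) : ¬ FredkinWord p q r s := by
  have h012 : ∀ x : Fin 3, x = 0 ∨ x = 1 ∨ x = 2 := by decide
  rcases h012 p with rfl | rfl | rfl
  · exact not_zero hpq hqr hrs
  · exact not_one hpq hqr hrs
  rcases h012 s with rfl | rfl | rfl
  · exact fun h => not_zero hrs.symm hqr.symm hpq.symm h.reverse
  · exact fun h => not_one hrs.symm hqr.symm hpq.symm h.reverse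
  have h2102 : ¬ FredkinWord 2 1 0 2 := fun h => not_2012 h.exchange
  have h2012 := not_2012
  fin_cases q <;> fin_cases r <;> first | assumption | contradiction

end FredkinWord

lemma not_fredkinWord (p q r s : Fin 3) : ¬ FredkinWord p q r s := by
  have avoid : ∀ x y : Fin 3, ∃ z, x ≠ z ∧ z ≠ y := by decide
  -- Merging equal neighbours frees a slot for the identity on a different pair. This can create a
  -- coincidence only further to the right, so repairs go from left to right.
  have h1 {p q r s : Fin 3} (hpq : p ≠ q) (hqr : q ≠ r) : ¬ FredkinWord p q r s := fun h => by
    by_cases hrs : r = s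
    · subst hrs
      obtain ⟨s, hs, -⟩ := avoid r r
      exact FredkinWord.not_of_ne hpq hqr hs (h.split_third s)
    · exact FredkinWord.not_of_ne hpq hqr hrs h
  have h2 {p q r s : Fin 3} (hpq : p ≠ q) : ¬ FredkinWord p q r s := fun h => by
    by_cases hqr : q = r
    · subst hqr
      obtain ⟨r, hr, -⟩ := avoid q s
      exact h1 hpq hr (h.split_second r)
    · exact h1 hpq hqr h
  intro h
  by_cases hpq : p = q
  · subst hpq
    obtain ⟨q, hq, -⟩ := avoid p r
    exact h2 hq (h.split_first q)
  · exact h2 hpq h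

theorem mul_four_ne_fredkin {G₁ G₂ G₃ G₄ : Matrix Idx3 Idx3 ℂ} (h₁ : IsTwoQubitGate G₁)
    (h₂ : IsTwoQubitGate G₂) (h₃ : IsTwoQubitGate G₃) (h₄ : IsTwoQubitGate G₄) :
    G₁ * G₂ * G₃ * G₄ ≠ fredkin := by
  obtain ⟨p, hp⟩ := isTwoQubitGate_iff.1 h₁
  obtain ⟨q, hq⟩ := isTwoQubitGate_iff.1 h₂
  obtain ⟨r, hr⟩ := isTwoQubitGate_iff.1 h₃
  obtain ⟨s, hs⟩ := isTwoQubitGate_iff.1 h₄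
  exact fun h => not_fredkinWord p q r s ⟨_, hp, _, hq, _, hr, _, hs, h⟩

/-- Padding with the identity gate makes implementability monotone, so excluding four gates excludes
all smaller numbers. -/
lemma ImplementableBy.succ {n : ℕ} {F : Matrix Idx3 Idx3 ℂ} (h : ImplementableBy n F) :
    ImplementableBy (n + 1) F := by
  obtain ⟨G, hG, hF⟩ := h
  refine ⟨Fin.cons 1 G, Fin.cases (isTwoQubitGate_iff.2 ⟨0, one_mem_pairGates 0⟩) hG, ?_⟩
  simp [List.ofFn_succ, hF]

lemma ImplementableBy.mono {m n : ℕ} {F : Matrix Idx3 Idx3 ℂ} (hmn : m ≤ n)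
    (h : ImplementableBy m F) : ImplementableBy n F :=
  Nat.le_induction h (fun _ _ => ImplementableBy.succ) n hmn

lemma not_implementableBy_four_fredkin : ¬ ImplementableBy 4 fredkin := by
  rintro ⟨G, hG, hF⟩
  refine mul_four_ne_fredkin (hG 0) (hG 1) (hG 2) (hG 3) ?_
  rw [← hF]
  simp [List.ofFn_succ, mul_assoc]

end ThreeQubit

theorem theorem5p4 :
    (∀ G₁ G₂ G₃ G₄ : Matrix ThreeQubit.Idx3 ThreeQubit.Idx3 ℂ,
      ThreeQubit.IsTwoQubitGate G₁ → ThreeQubit.IsTwoQubitGate G₂ →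
      ThreeQubit.IsTwoQubitGate G₃ → ThreeQubit.IsTwoQubitGate G₄ →
      G₁ * G₂ * G₃ * G₄ ≠ ThreeQubit.fredkin) ∧
    IsLeast {n : ℕ | ThreeQubit.ImplementableBy n ThreeQubit.fredkin} 5 := by
  refine ⟨fun _ _ _ _ => ThreeQubit.mul_four_ne_fredkin,
    ThreeQubit.implementableBy_five_fredkin, fun n hn => ?_⟩
  by_contra! hlt
  exact ThreeQubit.not_implementableBy_four_fredkin
    (ThreeQubit.ImplementableBy.mono (Nat.le_of_lt_succ hlt) hn)
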